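/- Work over $\mathbb{C}$, let $n\ge 0$, and give the space $M_n\times M_n$ of pairs of $n\times n$ matrices its Zariski topology. Let $B_+$ be the group of invertible upper triangular matrices and $N_+\subset B_+$ the subgroup of those with all diagonal entries equal to $1$. They act by $(U_1,U_2)\cdot X=U_1XU_2^{-1}$ on $M_n$ and by $(U_1,U_2)\cdot(X,Y)=(U_1XU_2^{-1},\,U_2YU_1^{-1})$ on $M_n\times M_n$. Let $E=\{(X,Y): XY \text{ and } YX \text{ are both upper triangular}\}$ and let $p:E\to M_n$, $p(X,Y)=X$. A partial permutation matrix is a $0,1$-matrix with at most one $1$ in each row and in each column. For a partial permutation matrix $\pi$ put $E_\pi=p^{-1}\big((B_+\times B_+)\cdot\pi\big)$. 1. For every $n\times n$ partial permutation matrix $\pi$, the stratum $E_\pi$ is a locally closed subset of $M_n\times M_n$ and, with its reduced structure, it is smooth and irreducible of dimension $n^2+\operatorname{rank}\pi$. 2. Suppose that $\pi$ is a permutation matrix. Then the set $$(N_+\times N_+)\cdot\big\{(\pi t,\,s\pi^{-1}) : s,t \text{ invertible diagonal, the diagonal entries of } st \text{ pairwise distinct}\big\}$$ is an open dense subset of $E_\pi$.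 Consequently the larger set $(N_+\times N_+)\cdot\{(\pi t,s\pi^{-1}) : s,t \text{ invertible diagonal}\}$, which is also contained in $E_\pi$, is dense in $E_\pi$ and contains an open dense subset of $E_\pi$. -/

import Mathlib

/-- A pair `(X, Y)` of complex `n × n` matrices. This is a structure of its own, so that it carries
the Zariski topology below and no Euclidean topology. -/
@[ext]
structure MatPair (n : ℕ) where
  X : Matrix (Fin n) (Fin n) ℂ
  Y : Matrix (Fin n) (Fin n) ℂ

namespace MatPair

/-- Index set of the `2 n²` coordinates: the entries of `X`, then the entries of `Y`. -/
abbrev Coord (n : ℕ) : Type := (Fin n × Fin n) ⊕ (Fin n × Fin n)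

/-- The coordinates of a pair: its matrix entries. -/
def coords {n : ℕ} (P : MatPair n) : Coord n → ℂ :=
  Sum.elim (fun a => P.X a.1 a.2) (fun a => P.Y a.1 a.2)

/-- The Zariski topology on pairs of matrices, seen as the complex points of affine space of
dimension `2 n²`. It is induced from the spectrum of the polynomial ring, where a point goes to the
ideal of the polynomials that vanish at it. -/
noncomputable instance zariskiTopology (n : ℕ) : TopologicalSpace (MatPair n) :=
  TopologicalSpace.induced
    (fun P => (MvPolynomial.pointToPoint P.coords : PrimeSpectrum (MvPolynomial (Coord n) ℂ)))
    PrimeSpectrum.zariskiTopology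

/-- The closed sets of this topology are the zero sets of families of polynomials. -/
theorem isClosed_iff_zeros {n : ℕ} (V : Set (MatPair n)) :
    IsClosed V ↔ ∃ S : Set (MvPolynomial (Coord n) ℂ),
      V = {P | ∀ f ∈ S, MvPolynomial.eval P.coords f = 0} := by
  have key : ∀ S : Set (MvPolynomial (Coord n) ℂ),
      (fun P : MatPair n =>
        (MvPolynomial.pointToPoint P.coords : PrimeSpectrum (MvPolynomial (Coord n) ℂ))) ⁻¹'
        PrimeSpectrum.zeroLocus S = {P | ∀ f ∈ S, MvPolynomial.eval P.coords f = 0} := by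
    intro S
    ext P
    simp only [Set.mem_preimage, PrimeSpectrum.mem_zeroLocus, Set.mem_ofPred_eq]
    constructor
    · intro h f hf
      simpa [MvPolynomial.aeval_eq_eval] using
        (MvPolynomial.mem_vanishingIdeal_singleton_iff P.coords f).1 (h hf)
    · intro h f hf
      refine (MvPolynomial.mem_vanishingIdeal_singleton_iff P.coords f).2 ?_
      simpa [MvPolynomial.aeval_eq_eval] using h f hf
  rw [isClosed_induced_iff]
  constructor
  · rintro ⟨T, hT, rfl⟩
    obtain ⟨S, rfl⟩ := (PrimeSpectrum.isClosed_iff_zeroLocus T).1 hT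
    exact ⟨S, key S⟩
  · rintro ⟨S, rfl⟩
    exact ⟨_, PrimeSpectrum.isClosed_zeroLocus S, key S⟩

/-- The coordinate ring of the Zariski closure of `V`, with its reduced structure: polynomials
modulo the ideal of those that vanish on `V`. -/
abbrev CoordRing {n : ℕ} (V : Set (MatPair n)) : Type :=
  MvPolynomial (Coord n) ℂ ⧸ MvPolynomial.vanishingIdeal ℂ (coords '' V)

/-- Evaluation at a point of `V`, as a map on the coordinate ring. -/
noncomputable def evalAt {n : ℕ} (V : Set (MatPair n)) (P : MatPair n) (hP : P ∈ V) :
    CoordRing V →ₐ[ℂ] ℂ :=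
  Ideal.Quotient.liftₐ (MvPolynomial.vanishingIdeal ℂ (coords '' V))
    (MvPolynomial.aeval P.coords) (fun _ hf => hf _ ⟨P, hP, rfl⟩)

/-- The point of the spectrum of the coordinate ring given by a point of `V`. -/
noncomputable def toSpec {n : ℕ} (V : Set (MatPair n)) (P : MatPair n) (hP : P ∈ V) :
    PrimeSpectrum (CoordRing V) :=
  ⟨RingHom.ker (evalAt V P hP), RingHom.ker_isPrime _⟩

/-- A Zariski locally closed `V`, with its reduced structure, is smooth over `ℂ`: the local ring at
each of its points is formally smooth over `ℂ`. As `V` is open in its closure, the local ring of `V`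
at a point is the local ring of the closure. -/
def IsSmoothLocallyClosed {n : ℕ} (V : Set (MatPair n)) : Prop :=
  IsLocallyClosed V ∧
    ∀ (P : MatPair n) (hP : P ∈ V), toSpec V P hP ∈ Algebra.smoothLocus ℂ (CoordRing V)

end MatPair

/-- The group `B₊` of invertible upper triangular matrices. -/
def upperBorel (n : ℕ) : Set (GL (Fin n) ℂ) :=
  {g | (g : Matrix (Fin n) (Fin n) ℂ).BlockTriangular id}

/-- The group `N₊` of upper triangular matrices with ones on the diagonal. -/
def upperUnipotent (n : ℕ) : Set (GL (Fin n) ℂ) :=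
  {g | (g : Matrix (Fin n) (Fin n) ℂ).BlockTriangular id ∧
    ∀ i, (g : Matrix (Fin n) (Fin n) ℂ) i i = 1}

/-- The action `(U₁, U₂) · X = U₁ X U₂⁻¹` on single matrices. -/
def actMat {n : ℕ} (U₁ U₂ : GL (Fin n) ℂ) (X : Matrix (Fin n) (Fin n) ℂ) :
    Matrix (Fin n) (Fin n) ℂ :=
  (U₁ : Matrix (Fin n) (Fin n) ℂ) * X * ((U₂⁻¹ : GL (Fin n) ℂ) : Matrix (Fin n) (Fin n) ℂ)

/-- The action `(U₁, U₂) · (X, Y) = (U₁ X U₂⁻¹, U₂ Y U₁⁻¹)` on pairs. -/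
def actPair {n : ℕ} (U₁ U₂ : GL (Fin n) ℂ) (P : MatPair n) : MatPair n :=
  ⟨actMat U₁ U₂ P.X, actMat U₂ U₁ P.Y⟩

/-- The upper-upper scheme `E` (its complex points): `XY` and `YX` are both upper triangular. -/
def upperUpper (n : ℕ) : Set (MatPair n) :=
  {P | (P.X * P.Y).BlockTriangular id ∧ (P.Y * P.X).BlockTriangular id}

/-- A partial permutation matrix: a `0,1`-matrix with at most one `1` in any row and column. -/
def IsPartialPermMatrix {n : ℕ} (π : Matrix (Fin n) (Fin n) ℂ) : Prop :=
  (∀ i j, π i j = 0 ∨ π i j = 1) ∧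
    (∀ i j j', π i j = 1 → π i j' = 1 → j = j') ∧
    (∀ i i' j, π i j = 1 → π i' j = 1 → i = i')

/-- A permutation matrix. -/
def IsPermMatrix {n : ℕ} (π : Matrix (Fin n) (Fin n) ℂ) : Prop :=
  ∃ σ : Equiv.Perm (Fin n), π = σ.permMatrix ℂ

/-- The orbit `(B₊ × B₊) · π`, which is the double coset `B₊ π B₊`. -/
def borelOrbit {n : ℕ} (π : Matrix (Fin n) (Fin n) ℂ) : Set (Matrix (Fin n) (Fin n) ℂ) :=
  {X | ∃ U₁ ∈ upperBorel n, ∃ U₂ ∈ upperBorel n, X = actMat U₁ U₂ π}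

/-- The stratum `E_π`: the preimage in `E` of the orbit of `π` under `p : (X, Y) ↦ X`. -/
def stratum {n : ℕ} (π : Matrix (Fin n) (Fin n) ℂ) : Set (MatPair n) :=
  {P | P ∈ upperUpper n ∧ P.X ∈ borelOrbit π}

/-- The point `(π t, s π⁻¹)`, for diagonal matrices `s` and `t` given by their diagonals. -/
noncomputable def torusPoint {n : ℕ} (π : Matrix (Fin n) (Fin n) ℂ) (s t : Fin n → ℂ) : MatPair n :=
  ⟨π * Matrix.diagonal t, Matrix.diagonal s * π⁻¹⟩

/-- The union of the `N₊ × N₊`-orbits of the points `(π t, s π⁻¹)` with `s`, `t` invertible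
diagonal. -/
def torusOrbits {n : ℕ} (π : Matrix (Fin n) (Fin n) ℂ) : Set (MatPair n) :=
  {P | ∃ s t : Fin n → ℂ, (∀ i, s i ≠ 0) ∧ (∀ i, t i ≠ 0) ∧
    ∃ U₁ ∈ upperUnipotent n, ∃ U₂ ∈ upperUnipotent n, P = actPair U₁ U₂ (torusPoint π s t)}

/-- The union of the `N₊ × N₊`-orbits of the points `(π t, s π⁻¹)` with `s`, `t` invertible
diagonal such that the diagonal entries of `s t` are pairwise distinct. -/
def genericTorusOrbits {n : ℕ} (π : Matrix (Fin n) (Fin n) ℂ) : Set (MatPair n) :=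
  {P | ∃ s t : Fin n → ℂ, (∀ i, s i ≠ 0) ∧ (∀ i, t i ≠ 0) ∧
    Function.Injective (fun i => s i * t i) ∧
    ∃ U₁ ∈ upperUnipotent n, ∃ U₂ ∈ upperUnipotent n, P = actPair U₁ U₂ (torusPoint π s t)}

/-- `S` is an open dense subset of `V`, for the topology that `V` inherits. -/
def IsOpenDenseIn {T : Type*} [TopologicalSpace T] (S V : Set T) : Prop :=
  (∃ U : Set T, IsOpen U ∧ S = V ∩ U) ∧ V ⊆ closure S

/-!
The stratum `E_π` has a global rational chart, from which its local closedness, smoothness,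
irreducibility and dimension are read off.

A partial permutation matrix `π` is encoded by an injective word `f : Fin n → ℕ`, in which `f i` is
the column of the one in row `i`, and is `n + i` if row `i` is zero. Every `X` in `B₊ π B₊` is of
the form `L π R`, where `L` is upper unipotent and supported on the inversions of `f`, and `R` is
invertible upper triangular with free entries in the rows that are columns of ones of `π`, the other
rows being those of the identity (`PivotWord.exists_left_right`). If `X = L π R`, then `(X, Y)`
lies in `E` exactly if `Y = adj R * G * adj L` with `π G` and `G π` upper triangular; the condition
on `G` says that certain entries of `G` vanish. So the free entries of `L`, `R` and `G`
parametrize `E_π` polynomially by the principal open set `det R ≠ 0` of an affine space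
(`PivotWord.mem_stratum_iff`). Its dimension is `n ^ 2 + rank π`, because the entries of `G` that
vanish correspond to the inversions of `f` and to the entries of `R` right of its diagonal
(`PivotWord.card_paramIdx`). Conversely, the entries of `L` and `R` are rational functions of those
of `X`: the equations `X = L (π R)` can be solved one at a time, from the lower left corner on
(`PivotWord.rows_left_mem_regular`), and `R Y L` is proportional to `G`.

For any set `V` with such a chart, with common denominator `b`, the coordinate ring localized at `b`
is a principal localization of a polynomial ring (`MatPair.RationalChart.isLocalization`). Hence `V`
is smooth, and it is open in its closure. It is irreducible as a polynomial image of a principal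
open set, and its dimension is the number of parameters: the chart embeds `V` into affine space, and
the coordinate slices through a point form a chain of maximal length.

For a permutation matrix `π`, the generic torus orbits are the points of `E_π` at which the diagonal
entries of `X Y` are nonzero and pairwise distinct (`genericTorusOrbits_eq`), an open condition;
density follows from irreducibility. To see that such a point lies on a torus orbit, one moves `X`
to `π`. Then `M = X Y` is upper triangular, also after conjugation by `π`. An upper triangular
matrix with distinct diagonal entries is diagonalized by a matrix whose columns are columns of
polynomials in `M` (`exists_diagonalization`), so that this matrix is triangular for both orders as
well and moves the pair to the torus.
-/

/-! ### Sets with a rational chart: coordinate ring, irreducibility and smoothness -/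

namespace MatPair
open MvPolynomial

theorem eval_bind {σ τ : Type*} (φ : σ → MvPolynomial τ ℂ) (p : MvPolynomial σ ℂ) (x : τ → ℂ) :
    eval x (bind₁ φ p) = eval (fun i => eval x (φ i)) p := by
  rw [← coe_aeval_eq_eval, ← coe_aeval_eq_eval]
  exact aeval_bind₁ x φ p

/-- Two polynomials that agree where `h ≠ 0` are equal. -/
theorem eq_of_eval_eq_of_ne_zero {K : Type*} {h p q : MvPolynomial K ℂ} (hh : h ≠ 0)
    (H : ∀ x, eval x h ≠ 0 → eval x p = eval x q) : p = q := by
  have : h * (p - q) = 0 := by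
    refine MvPolynomial.funext fun x => ?_
    by_cases hx : eval x h = 0
    · simp [hx]
    · simp [H x hx]
  exact sub_eq_zero.1 ((mul_eq_zero.1 this).resolve_left hh)

theorem exists_eval_ne_zero {K : Type*} {p : MvPolynomial K ℂ} (hp : p ≠ 0) :
    ∃ x, eval x p ≠ 0 := by
  by_contra! H
  exact hp (MvPolynomial.funext fun x => by simpa using H x)

theorem exists_coords_eq {n : ℕ} (v : Coord n → ℂ) : ∃ P : MatPair n, P.coords = v := by
  refine ⟨⟨fun i j => v (.inl (i, j)), fun i j => v (.inr (i, j))⟩, ?_⟩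
  funext i
  rcases i with i | i <;> rfl

theorem isOpen_eval_ne_zero {n : ℕ} (f : MvPolynomial (Coord n) ℂ) :
    IsOpen {P : MatPair n | eval P.coords f ≠ 0} := by
  rw [← isClosed_compl_iff, isClosed_iff_zeros]
  exact ⟨{f}, by ext; simp⟩

/-- The image of a nonempty principal open subset of affine space under a polynomial map is
irreducible. -/
theorem isIrreducible_image {n : ℕ} {K : Type*} (φ : Coord n → MvPolynomial K ℂ)
    {h : MvPolynomial K ℂ} (hh : h ≠ 0) {V : Set (MatPair n)}
    (hV : ∀ P, P ∈ V ↔ ∃ x, eval x h ≠ 0 ∧ ∀ i, P.coords i = eval x (φ i)) :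
    IsIrreducible V := by
  have mk : ∀ x, eval x h ≠ 0 → ∃ P ∈ V, P.coords = fun i => eval x (φ i) := fun x hx => by
    obtain ⟨P, hc⟩ := exists_coords_eq fun i => eval x (φ i)
    exact ⟨P, (hV _).2 ⟨x, hx, fun i => congrFun hc i⟩, hc⟩
  -- An open set that meets `V` contains the nonvanishing locus of a polynomial whose pullback is
  -- not zero.
  have key : ∀ U : Set (MatPair n), IsOpen U → (V ∩ U).Nonempty →
      ∃ f : MvPolynomial (Coord n) ℂ, {P | eval P.coords f ≠ 0} ⊆ U ∧ bind₁ φ f ≠ 0 := by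
    rintro U hU ⟨P, hPV, hPU⟩
    obtain ⟨S, hS⟩ := (isClosed_iff_zeros Uᶜ).1 hU.isClosed_compl
    have hP : P ∉ Uᶜ := fun h => h hPU
    rw [hS] at hP
    simp only [Set.mem_ofPred_eq, not_forall] at hP
    obtain ⟨f, hf, hne⟩ := hP
    refine ⟨f, fun Q hQ => ?_, fun h0 => hne ?_⟩
    · by_contra hQU
      have : Q ∈ Uᶜ := hQU
      rw [hS] at this
      exact hQ (this f hf)
    · obtain ⟨x, -, hx⟩ := (hV P).1 hPV
      rw [_root_.funext hx, ← eval_bind, h0, map_zero]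
  refine ⟨?_, ?_⟩
  · obtain ⟨x, hx⟩ := exists_eval_ne_zero hh
    obtain ⟨P, hP, -⟩ := mk x hx
    exact ⟨P, hP⟩
  · intro U₁ U₂ h₁ h₂ n₁ n₂
    obtain ⟨f₁, hs₁, hf₁⟩ := key U₁ h₁ n₁
    obtain ⟨f₂, hs₂, hf₂⟩ := key U₂ h₂ n₂
    obtain ⟨x, hx⟩ := exists_eval_ne_zero (mul_ne_zero (mul_ne_zero hh hf₁) hf₂)
    simp only [map_mul, mul_ne_zero_iff] at hx
    obtain ⟨P, hP, hc⟩ := mk x hx.1.1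
    refine ⟨P, hP, hs₁ ?_, hs₂ ?_⟩
    · simpa [hc, ← eval_bind] using hx.1.2
    · simpa [hc, ← eval_bind] using hx.2

/-- A rational chart on a set `V` of pairs of matrices: a polynomial parametrization `φ` of `V` by a
nonempty principal open subset `D(h)` of the affine space `ℂ^K`, such that the parameters are
the rational functions `a k / b` on `V`. -/
structure RationalChart {n : ℕ} (K : Type*) (V : Set (MatPair n)) where
  φ : Coord n → MvPolynomial K ℂ
  h : MvPolynomial K ℂ
  h_ne : h ≠ 0
  mem_iff : ∀ P, P ∈ V ↔ ∃ x, eval x h ≠ 0 ∧ ∀ i, P.coords i = eval x (φ i)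
  b : MvPolynomial (Coord n) ℂ
  a : K → MvPolynomial (Coord n) ℂ
  eval_b : ∀ x, eval x h ≠ 0 → eval (fun i => eval x (φ i)) b ≠ 0
  eval_a : ∀ x, eval x h ≠ 0 → ∀ k,
    x k * eval (fun i => eval x (φ i)) b = eval (fun i => eval x (φ i)) (a k)

namespace RationalChart

variable {n : ℕ} {K : Type*} {V : Set (MatPair n)} (c : RationalChart K V)

theorem isIrreducible (c : RationalChart K V) : IsIrreducible V :=
  isIrreducible_image c.φ c.h_ne c.mem_iff

theorem bind_b_ne_zero : bind₁ c.φ c.b ≠ 0 := by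
  intro h0
  refine c.h_ne (MvPolynomial.funext fun x => ?_)
  by_contra hx
  refine c.eval_b x (by simpa using hx) ?_
  rw [← eval_bind, h0, map_zero]

theorem bind_a (k : K) : bind₁ c.φ (c.a k) = MvPolynomial.X k * bind₁ c.φ c.b :=
  eq_of_eval_eq_of_ne_zero c.h_ne fun x hx => by
    rw [map_mul, eval_bind, eval_bind, eval_X, c.eval_a x hx]

/-- Every polynomial in the parameters is, up to a power of the denominator, the pullback of a
polynomial in the matrix entries. -/
theorem exists_bind_eq (g : MvPolynomial K ℂ) :
    ∃ (m : ℕ) (f : MvPolynomial (Coord n) ℂ), bind₁ c.φ f = g * bind₁ c.φ c.b ^ m := by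
  induction g using MvPolynomial.induction_on with
  | C r => exact ⟨0, C r, by simp⟩
  | add p q hp hq =>
    obtain ⟨m, f, hf⟩ := hp
    obtain ⟨m', f', hf'⟩ := hq
    refine ⟨m + m', f * c.b ^ m' + f' * c.b ^ m, ?_⟩
    simp only [map_add, map_mul, map_pow, hf, hf']
    ring
  | mul_X p k hp =>
    obtain ⟨m, f, hf⟩ := hp
    refine ⟨m + 1, f * c.a k, ?_⟩
    rw [map_mul, hf, c.bind_a]
    ring

theorem mem_vanishingIdeal_iff_bind (f : MvPolynomial (Coord n) ℂ) :
    f ∈ vanishingIdeal ℂ (coords '' V) ↔ bind₁ c.φ f = 0 := by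
  rw [mem_vanishingIdeal_iff]
  constructor
  · intro H
    refine eq_of_eval_eq_of_ne_zero c.h_ne fun x hx => ?_
    obtain ⟨P, hc⟩ := exists_coords_eq fun i => eval x (c.φ i)
    have := H _ ⟨_, (c.mem_iff _).2 ⟨x, hx, fun i => congrFun hc i⟩, hc⟩
    rw [aeval_eq_eval] at this
    rw [eval_bind, map_zero]
    exact this
  · rintro H _ ⟨P, hP, rfl⟩
    obtain ⟨x, -, hx⟩ := (c.mem_iff P).1 hP
    rw [aeval_eq_eval, _root_.funext hx]
    change eval _ f = 0
    rw [← eval_bind, H, map_zero]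

/-- The pullback along the parametrization, from the coordinate ring of `V`. -/
noncomputable def pullback : CoordRing V →ₐ[ℂ] MvPolynomial K ℂ :=
  Ideal.Quotient.liftₐ _ (bind₁ c.φ) fun f hf => (c.mem_vanishingIdeal_iff_bind f).1 hf

@[simp]
theorem pullback_mk (f : MvPolynomial (Coord n) ℂ) :
    c.pullback (Ideal.Quotient.mk _ f) = bind₁ c.φ f := rfl

theorem pullback_injective : Function.Injective c.pullback := by
  rw [injective_iff_map_eq_zero]
  intro z hz
  obtain ⟨f, rfl⟩ := Ideal.Quotient.mk_surjective z
  exact Ideal.Quotient.eq_zero_iff_mem.2 ((c.mem_vanishingIdeal_iff_bind f).2 hz)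

/-- The localization of the polynomial ring in the parameters at the pullback of the denominator
`b`. Its principal open set may be larger than `D(h)`. -/
abbrev Ring : Type _ := Localization.Away (bind₁ c.φ c.b)

/-- The ring of the chart as an algebra over the coordinate ring, through the pullback. -/
noncomputable abbrev algebra : Algebra (CoordRing V) c.Ring :=
  ((algebraMap (MvPolynomial K ℂ) c.Ring).comp c.pullback.toRingHom).toAlgebra

/-- The chart identifies the coordinate ring of `V` localized at the denominator `b` with a
principal localization of a polynomial ring. -/
theorem isLocalization :
    letI := c.algebra
    IsLocalization.Away (Ideal.Quotient.mk (vanishingIdeal ℂ (coords '' V)) c.b) c.Ring := by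
  let := c.algebra
  have hmap : ∀ z : CoordRing V, algebraMap (CoordRing V) c.Ring z =
      algebraMap (MvPolynomial K ℂ) c.Ring (c.pullback z) := fun _ => rfl
  have hinj : Function.Injective (algebraMap (MvPolynomial K ℂ) c.Ring) :=
    IsLocalization.injective _ (powers_le_nonZeroDivisors_of_noZeroDivisors c.bind_b_ne_zero)
  have hu : IsUnit (algebraMap (MvPolynomial K ℂ) c.Ring (bind₁ c.φ c.b)) :=
    IsLocalization.Away.algebraMap_isUnit _
  constructor
  refine ⟨?_, ?_, ?_⟩
  · rintro ⟨_, m, rfl⟩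
    change IsUnit (algebraMap _ c.Ring (_ ^ m))
    rw [map_pow]
    exact hu.pow m
  · intro z
    obtain ⟨⟨g, _, m, rfl⟩, hg⟩ :=
      IsLocalization.surj (M := Submonoid.powers (bind₁ c.φ c.b)) z
    obtain ⟨l, f, hf⟩ := c.exists_bind_eq g
    refine ⟨⟨Ideal.Quotient.mk _ f, _, m + l, rfl⟩, ?_⟩
    change z * algebraMap _ c.Ring (_ ^ (m + l)) = _
    have hg' : z * algebraMap _ c.Ring (bind₁ c.φ c.b ^ m) = algebraMap _ c.Ring g := hg
    rw [hmap, hmap, map_pow, pullback_mk, pullback_mk, hf, map_mul, ← hg', mul_assoc, ← map_mul,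
      pow_add]
  · intro y z hyz
    rw [hmap, hmap] at hyz
    exact ⟨1, by rw [c.pullback_injective (hinj hyz)]⟩

theorem mem_smoothLocus (c : RationalChart K V) (P : MatPair n) (hP : P ∈ V) :
    toSpec V P hP ∈ Algebra.smoothLocus ℂ (CoordRing V) := by
  let := c.algebra
  have : IsScalarTower ℂ (CoordRing V) c.Ring := by
    refine IsScalarTower.of_algebraMap_eq (R := ℂ) (S := CoordRing V) (A := c.Ring) fun r => ?_
    change _ = algebraMap (MvPolynomial K ℂ) c.Ring (c.pullback (algebraMap ℂ _ r))
    rw [AlgHom.commutes]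
    exact IsScalarTower.algebraMap_apply ℂ (MvPolynomial K ℂ) c.Ring r
  have := c.isLocalization
  set β := Ideal.Quotient.mk (vanishingIdeal ℂ (coords '' V)) c.b
  have : Algebra.FormallySmooth ℂ c.Ring := by
    have : Algebra.FormallySmooth (MvPolynomial K ℂ) c.Ring :=
      .of_isLocalization (.powers (bind₁ c.φ c.b))
    exact .comp ℂ (MvPolynomial K ℂ) c.Ring
  have hsm : Algebra.FormallySmooth ℂ (Localization.Away β) :=
    .of_equiv ((IsLocalization.algEquiv (.powers β) c.Ring (Localization.Away β)).restrictScalars ℂ)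
  have : Algebra.FinitePresentation ℂ (CoordRing V) :=
    .of_finiteType.1 inferInstance
  refine Algebra.basicOpen_subset_smoothLocus_iff.2 hsm ?_
  change β ∉ RingHom.ker (evalAt V P hP)
  rw [RingHom.mem_ker]
  obtain ⟨x, hx, hc⟩ := (c.mem_iff P).1 hP
  have := c.eval_b x hx
  rw [← _root_.funext hc] at this
  exact this

/-! ### Sets with a rational chart: local closedness and dimension -/

/-- The point of the parameter space below a pair of matrices. -/
noncomputable def param (P : MatPair n) (k : K) : ℂ :=
  eval P.coords (c.a k) / eval P.coords c.b

theorem param_eq {P : MatPair n} {x : K → ℂ} (hx : eval x c.h ≠ 0)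
    (hP : ∀ i, P.coords i = eval x (c.φ i)) : c.param P = x := by
  funext k
  rw [param, div_eq_iff (by rw [_root_.funext hP]; exact c.eval_b x hx), _root_.funext hP,
    c.eval_a x hx]

theorem eval_param_h_ne_zero {P : MatPair n} (hP : P ∈ V) : eval (c.param P) c.h ≠ 0 := by
  obtain ⟨x, hx, hc⟩ := (c.mem_iff P).1 hP
  rwa [c.param_eq hx hc]

theorem coords_eq {P : MatPair n} (hP : P ∈ V) :
    P.coords = fun i => eval (c.param P) (c.φ i) := by
  obtain ⟨x, hx, hc⟩ := (c.mem_iff P).1 hP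
  rw [c.param_eq hx hc]
  exact _root_.funext hc

theorem eval_b_ne_zero {P : MatPair n} (hP : P ∈ V) : eval P.coords c.b ≠ 0 := by
  rw [c.coords_eq hP]
  exact c.eval_b _ (c.eval_param_h_ne_zero hP)

theorem eval_coords {P : MatPair n} (hP : P ∈ V) (f : MvPolynomial (Coord n) ℂ) :
    eval P.coords f = eval (c.param P) (bind₁ c.φ f) := by
  rw [eval_bind, ← c.coords_eq hP]

/-- The vanishing of a polynomial in the parameters is, on `V`, that of a polynomial in the matrix
entries. -/
theorem exists_eval_eq (g : MvPolynomial K ℂ) :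
    ∃ f : MvPolynomial (Coord n) ℂ,
      ∀ P ∈ V, (eval P.coords f = 0 ↔ eval (c.param P) g = 0) := by
  obtain ⟨m, f, hf⟩ := c.exists_bind_eq g
  refine ⟨f, fun P hP => ?_⟩
  rw [c.eval_coords hP, hf, map_mul, map_pow, ← c.eval_coords hP]
  simp [c.eval_b_ne_zero hP]

/-- The set `V` is cut out in its closure by the nonvanishing of the denominator `b` and of a
polynomial that pulls back to `h` up to a power of `b`. -/
theorem isLocallyClosed (c : RationalChart K V) : IsLocallyClosed V := by
  obtain ⟨m, f, hf⟩ := c.exists_bind_eq c.h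
  refine ⟨{P | eval P.coords c.b ≠ 0} ∩ {P | eval P.coords f ≠ 0},
    {P | ∀ g ∈ (vanishingIdeal ℂ (coords '' V) : Set (MvPolynomial (Coord n) ℂ)),
      eval P.coords g = 0},
    (isOpen_eval_ne_zero _).inter (isOpen_eval_ne_zero _), (isClosed_iff_zeros _).2 ⟨_, rfl⟩, ?_⟩
  ext P
  constructor
  · refine fun hP => ⟨⟨c.eval_b_ne_zero hP, ?_⟩, fun g hg => ?_⟩
    · change eval P.coords f ≠ 0
      rw [c.eval_coords hP, hf, map_mul, map_pow, ← c.eval_coords hP]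
      exact mul_ne_zero (c.eval_param_h_ne_zero hP) (pow_ne_zero _ (c.eval_b_ne_zero hP))
    · rw [c.eval_coords hP, (c.mem_vanishingIdeal_iff_bind g).1 hg, map_zero]
  · rintro ⟨⟨hb, hh⟩, hZ⟩
    let := c.algebra
    have := c.isLocalization
    -- Evaluation at `P` extends to the ring of the chart, which gives the parameters of `P`.
    let ev : CoordRing V →+* ℂ := Ideal.Quotient.lift _ (eval P.coords) hZ
    have hu : IsUnit (ev (Ideal.Quotient.mk _ c.b)) := isUnit_iff_ne_zero.2 hb
    let l : c.Ring →+* ℂ := IsLocalization.Away.lift _ hu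
    have hl : ∀ g, l (algebraMap _ c.Ring (bind₁ c.φ g)) = eval P.coords g := fun g =>
      IsLocalization.Away.lift_eq _ hu (Ideal.Quotient.mk _ g)
    let x : K → ℂ := fun k => l (algebraMap (MvPolynomial K ℂ) c.Ring (MvPolynomial.X k))
    have hx : ∀ g, eval x g = l (algebraMap _ c.Ring g) := by
      intro g
      have : eval x = l.comp (algebraMap _ c.Ring) := by
        refine MvPolynomial.ringHom_ext (fun r => ?_) fun k => ?_
        · have := hl (C r)
          rw [bind₁_C_right, eval_C] at this
          rw [eval_C]
          exact this.symm
        · rw [eval_X]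
          rfl
      rw [this]
      rfl
    have hbind : ∀ g, eval P.coords g = eval x (bind₁ c.φ g) := fun g => by rw [hx, hl]
    refine (c.mem_iff P).2 ⟨x, fun h0 => hh ?_, fun i => ?_⟩
    · rw [hbind, hf, map_mul, h0, zero_mul]
    · have := hbind (MvPolynomial.X i)
      rwa [eval_X, bind₁_X_right] at this

/-- Closed subsets of `V` are the loci where polynomials in the parameters vanish. -/
theorem isInducing_param :
    Topology.IsInducing fun P : V =>
      (pointToPoint (c.param P) : PrimeSpectrum (MvPolynomial K ℂ)) := by
  have hz : ∀ (x : K → ℂ) (S : Set (MvPolynomial K ℂ)),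
      (pointToPoint x : PrimeSpectrum (MvPolynomial K ℂ)) ∈ PrimeSpectrum.zeroLocus S ↔
        ∀ g ∈ S, eval x g = 0 := by
    intro x S
    rw [PrimeSpectrum.mem_zeroLocus]
    constructor
    · intro h g hg
      simpa [aeval_eq_eval] using (mem_vanishingIdeal_singleton_iff x g).1 (h hg)
    · intro h g hg
      refine (mem_vanishingIdeal_singleton_iff x g).2 ?_
      simpa [aeval_eq_eval] using h g hg
  constructor
  refine TopologicalSpace.ext_iff_isClosed.2 fun Z => ?_
  rw [isClosed_induced_iff, isClosed_induced_iff]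
  constructor
  · rintro ⟨T, hT, rfl⟩
    obtain ⟨S, rfl⟩ := (isClosed_iff_zeros T).1 hT
    refine ⟨_, PrimeSpectrum.isClosed_zeroLocus (bind₁ c.φ '' S), ?_⟩
    ext ⟨P, hP⟩
    simp [hz, c.eval_coords hP]
  · rintro ⟨T, hT, rfl⟩
    obtain ⟨S, rfl⟩ := (PrimeSpectrum.isClosed_iff_zeroLocus T).1 hT
    choose F hF using c.exists_eval_eq
    refine ⟨_, (isClosed_iff_zeros _).2 ⟨F '' S, rfl⟩, ?_⟩
    ext ⟨P, hP⟩
    simp [hz, hF _ P hP]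

/-- An irreducible subset of the ambient space is irreducible in a subspace containing it. -/
theorem _root_.IsIrreducible.of_image_val {T : Type*} [TopologicalSpace T] {V : Set T} {S : Set V}
    (hS : IsIrreducible (Subtype.val '' S)) : IsIrreducible S := by
  refine ⟨hS.1.of_image, ?_⟩
  rintro _ _ ⟨U₁, h₁, rfl⟩ ⟨U₂, h₂, rfl⟩ ⟨x, hx, hx'⟩ ⟨y, hy, hy'⟩
  obtain ⟨_, ⟨z, hz, rfl⟩, hz'⟩ := hS.2 U₁ U₂ h₁ h₂ ⟨_, ⟨x, hx, rfl⟩, hx'⟩ ⟨_, ⟨y, hy, rfl⟩, hy'⟩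
  exact ⟨z, hz, hz'⟩

/-- The locus in `V` where the parameters with index outside of `s` are those of `x₀`. -/
def slice (x₀ : K → ℂ) (s : Set K) : Set V :=
  {P | ∀ k, k ∉ s → c.param P k = x₀ k}

theorem isClosed_slice (x₀ : K → ℂ) (s : Set K) : IsClosed (c.slice x₀ s) := by
  choose F hF using c.exists_eval_eq
  refine isClosed_induced_iff.2 ⟨_, (isClosed_iff_zeros _).2
    ⟨{f | ∃ k, k ∉ s ∧ f = F (MvPolynomial.X k - C (x₀ k))}, rfl⟩, ?_⟩
  ext ⟨P, hP⟩
  constructor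
  · intro H k hk
    have := (hF _ P hP).1 (H _ ⟨k, hk, rfl⟩)
    simpa [sub_eq_zero] using this
  · rintro H _ ⟨k, hk, rfl⟩
    refine (hF _ P hP).2 ?_
    simpa [sub_eq_zero] using H k hk

open Classical in
/-- Substitution of the coordinates of `x₀` for the variables outside of `s`. -/
noncomputable def restrict (x₀ : K → ℂ) (s : Set K) : MvPolynomial K ℂ →ₐ[ℂ] MvPolynomial K ℂ :=
  bind₁ fun k => if k ∈ s then MvPolynomial.X k else C (x₀ k)

open Classical in
theorem eval_restrict (x₀ : K → ℂ) (s : Set K) (x : K → ℂ) (g : MvPolynomial K ℂ) :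
    eval x (restrict x₀ s g) = eval (fun k => if k ∈ s then x k else x₀ k) g := by
  rw [restrict, eval_bind]
  congr 2
  funext k
  split_ifs <;> simp

theorem restrict_ne_zero {x₀ : K → ℂ} (s : Set K) {g : MvPolynomial K ℂ} (h : eval x₀ g ≠ 0) :
    restrict x₀ s g ≠ 0 := by
  intro h0
  have := eval_restrict x₀ s x₀ g
  simp only [ite_self] at this
  rw [h0, map_zero] at this
  exact h this.symm

theorem exists_param_eq {x : K → ℂ} (hx : eval x c.h ≠ 0) : ∃ P : V, c.param P = x := by
  obtain ⟨P, hc⟩ := exists_coords_eq fun i => eval x (c.φ i)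
  exact ⟨⟨P, (c.mem_iff _).2 ⟨x, hx, congrFun hc⟩⟩, c.param_eq hx (congrFun hc)⟩

theorem isIrreducible_slice {x₀ : K → ℂ} (h₀ : eval x₀ c.h ≠ 0) (s : Set K) :
    IsIrreducible (c.slice x₀ s) := by
  classical
  refine IsIrreducible.of_image_val (isIrreducible_image (fun i => restrict x₀ s (c.φ i))
    (restrict_ne_zero s h₀) fun P => ?_)
  simp only [eval_restrict]
  constructor
  · rintro ⟨⟨P, hP⟩, hs, rfl⟩
    have : (fun k => if k ∈ s then c.param P k else x₀ k) = c.param P := by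
      funext k
      split_ifs with hk
      · rfl
      · exact (hs k hk).symm
    refine ⟨c.param P, ?_⟩
    rw [this]
    exact ⟨c.eval_param_h_ne_zero hP, congrFun (c.coords_eq hP)⟩
  · rintro ⟨x, hx, hP⟩
    refine ⟨⟨P, (c.mem_iff P).2 ⟨_, hx, hP⟩⟩, fun k hk => ?_, rfl⟩
    change c.param P k = _
    rw [c.param_eq hx hP]
    exact if_neg hk

theorem slice_lt_slice {x₀ : K → ℂ} (h₀ : eval x₀ c.h ≠ 0) {s t : Set K} (hst : s ⊂ t) :
    c.slice x₀ s < c.slice x₀ t := by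
  classical
  obtain ⟨hle, j, hjt, hjs⟩ := Set.ssubset_iff_exists.1 hst
  refine Set.ssubset_iff_exists.2 ⟨fun P hP k hk => hP k fun h => hk (hle h), ?_⟩
  have hX : (MvPolynomial.X j - C (x₀ j) : MvPolynomial K ℂ) ≠ 0 := fun h0 => by
    have := congrArg (eval fun _ => x₀ j + 1) h0
    simp at this
  obtain ⟨x, hx⟩ := exists_eval_ne_zero (mul_ne_zero (restrict_ne_zero t h₀) hX)
  rw [map_mul, mul_ne_zero_iff, eval_restrict] at hx
  obtain ⟨P, hP⟩ := c.exists_param_eq hx.1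
  refine ⟨P, fun k hk => (congrFun hP k).trans (if_neg hk), fun hPs => hx.2 ?_⟩
  have := hPs j hjs
  rw [hP] at this
  simpa [hjt, sub_eq_zero] using this

/-- The chart embeds `V` into an affine space of dimension `|K|`, and the slices through a point
along a flag of coordinate subspaces form a chain of length `|K|`. -/
theorem topologicalKrullDim_eq [Fintype K] (c : RationalChart K V) :
    topologicalKrullDim V = (Fintype.card K : WithBot ℕ∞) := by
  apply le_antisymm
  · refine c.isInducing_param.topologicalKrullDim_le.trans ?_
    rw [PrimeSpectrum.topologicalKrullDim_eq_ringKrullDim,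
      MvPolynomial.ringKrullDim_of_isNoetherianRing, ringKrullDim_eq_zero_of_field]
    simp
  · obtain ⟨x₀, h₀⟩ := exists_eval_ne_zero c.h_ne
    -- The slices through `x₀` along the first `m` coordinates, for `m = 0, …, |K|`.
    let e := Fintype.equivFin K
    let F : Fin (Fintype.card K + 1) → TopologicalSpace.IrreducibleCloseds V := fun m =>
      ⟨c.slice x₀ {k | (e k : ℕ) < m}, c.isIrreducible_slice h₀ _, c.isClosed_slice _ _⟩
    let L : LTSeries (TopologicalSpace.IrreducibleCloseds V) :=
      ⟨Fintype.card K, F, fun m => by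
        refine c.slice_lt_slice h₀ (Set.ssubset_iff_exists.2 ⟨fun k hk => ?_, e.symm m, ?_, ?_⟩)
        · exact lt_trans (show (e k : ℕ) < m from hk) (Nat.lt_succ_self _)
        · simp
        · simp⟩
    exact Order.LTSeries.length_le_krullDim L

end RationalChart
end MatPair

/-! ### A parametrization of the strata -/

namespace PivotWord
open Matrix

/-- A word that encodes a partial permutation matrix: `f i < n` is the column of the one in row
`i`, and `f i = n + i` if row `i` is zero. -/
structure _root_.IsPivotWord {n : ℕ} (f : Fin n → ℕ) : Prop where
  injective : Function.Injective f
  eq_add : ∀ i, n ≤ f i → f i = n + i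

variable {n : ℕ} (f : Fin n → ℕ) {R S : Type*} [CommRing R] [CommRing S]

/-- The partial permutation matrix of a word. -/
def pivotMatrix (R : Type*) [CommRing R] : Matrix (Fin n) (Fin n) R :=
  Matrix.of fun i j => if f i = j then 1 else 0

/-- Positions of the parameters of the left unipotent factor: the inversions of the word. -/
abbrev LeftIdx : Type := {a : Fin n × Fin n // a.1 < a.2 ∧ f a.2 < f a.1}

/-- Positions of the parameters of the right factor: `(i, j)` stands for the entry in column `j` of
the row `f i`. -/
abbrev RightIdx : Type := {a : Fin n × Fin n // f a.1 ≤ a.2}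

/-- Positions of the entries that are free in a matrix `G` such that `π G` and `G π` are both upper
triangular. -/
abbrev FiberIdx : Type :=
  {a : Fin n × Fin n // (a.1 : ℕ) ≤ f a.2 ∧ ∀ p, f p = a.1 → p ≤ a.2}

/-- Index type of all the parameters of the stratum. -/
abbrev ParamIdx : Type := LeftIdx f ⊕ RightIdx f ⊕ FiberIdx f

variable {f}

/-- The left unipotent factor. -/
def left (c : ParamIdx f → R) : Matrix (Fin n) (Fin n) R :=
  Matrix.of fun i p => if i = p then 1 else
    if h : i < p ∧ f p < f i then c (.inl ⟨(i, p), h⟩) else 0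

/-- The product of the partial permutation matrix and the right factor. -/
def rows (c : ParamIdx f → R) : Matrix (Fin n) (Fin n) R :=
  Matrix.of fun i j => if h : f i ≤ j then c (.inr (.inl ⟨(i, j), h⟩)) else 0

/-- The right factor: an upper triangular matrix whose rows outside the columns of the pivots are
those of the identity. -/
noncomputable def right (c : ParamIdx f → R) : Matrix (Fin n) (Fin n) R :=
  Matrix.of fun k j => if h : ∃ i, f i = k then rows c h.choose j else if k = j then 1 else 0

/-- The general matrix `G` such that `π G` and `G π` are both upper triangular. -/
def fiber (c : ParamIdx f → R) : Matrix (Fin n) (Fin n) R :=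
  Matrix.of fun j k =>
    if h : (j : ℕ) ≤ f k ∧ ∀ p, f p = j → p ≤ k then c (.inr (.inr ⟨(j, k), h⟩)) else 0

/-- The `X` component of the parametrization of the stratum. -/
noncomputable def pointX (c : ParamIdx f → R) : Matrix (Fin n) (Fin n) R :=
  left c * pivotMatrix f R * right c

/-- The `Y` component of the parametrization of the stratum. The adjugates stand for the inverses,
up to a scalar factor, so that the entries are polynomials in the parameters. -/
noncomputable def pointY (c : ParamIdx f → R) : Matrix (Fin n) (Fin n) R :=
  (right c).adjugate * fiber c * (left c).adjugate

/-! ### Compatibility with ring homomorphisms -/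

theorem map_pivotMatrix (g : R →+* S) : (pivotMatrix f R).map g = pivotMatrix f S := by
  ext i j
  simp [pivotMatrix, apply_ite g]

theorem map_left (g : R →+* S) (c : ParamIdx f → R) : (left c).map g = left (g ∘ c) := by
  ext i j
  simp only [left, Matrix.map_apply, Matrix.of_apply]
  split_ifs <;> simp

theorem map_rows (g : R →+* S) (c : ParamIdx f → R) : (rows c).map g = rows (g ∘ c) := by
  ext i j
  simp only [rows, Matrix.map_apply, Matrix.of_apply]
  split_ifs <;> simp

theorem map_right (g : R →+* S) (c : ParamIdx f → R) : (right c).map g = right (g ∘ c) := by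
  ext i j
  simp only [right, Matrix.map_apply, Matrix.of_apply, ← map_rows]
  split_ifs <;> simp

theorem map_fiber (g : R →+* S) (c : ParamIdx f → R) : (fiber c).map g = fiber (g ∘ c) := by
  ext i j
  simp only [fiber, Matrix.map_apply, Matrix.of_apply]
  split_ifs <;> simp

theorem map_pointX (g : R →+* S) (c : ParamIdx f → R) : (pointX c).map g = pointX (g ∘ c) := by
  simp [pointX, Matrix.map_mul, map_left, map_right, map_pivotMatrix]

theorem map_pointY (g : R →+* S) (c : ParamIdx f → R) : (pointY c).map g = pointY (g ∘ c) := by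
  have h : ∀ M : Matrix (Fin n) (Fin n) R, M.adjugate.map g = (M.map g).adjugate :=
    fun M => g.map_adjugate M
  simp [pointY, Matrix.map_mul, map_left, map_right, map_fiber, h]

/-! ### The shape of the factors -/

theorem left_apply_self (c : ParamIdx f → R) (i : Fin n) : left c i i = 1 := by
  simp [left]

theorem left_apply_of_not (c : ParamIdx f → R) {i p : Fin n} (hip : i ≠ p)
    (h : ¬(i < p ∧ f p < f i)) : left c i p = 0 := by
  simp [left, hip, h]

theorem left_blockTriangular (c : ParamIdx f → R) : (left c).BlockTriangular id :=
  fun _ _ h => left_apply_of_not c (ne_of_gt h) fun h' => lt_asymm h h'.1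

theorem det_left (c : ParamIdx f → R) : (left c).det = 1 := by
  rw [Matrix.det_of_isUpperTriangular (left_blockTriangular c)]
  exact Finset.prod_eq_one fun i _ => left_apply_self c i

theorem rows_apply_of_lt (c : ParamIdx f → R) {i j : Fin n} (h : (j : ℕ) < f i) :
    rows c i j = 0 := by
  simp [rows, not_le.2 h]

theorem right_apply (hf : IsPivotWord f) (c : ParamIdx f → R) {i k : Fin n} (h : f i = k)
    (j : Fin n) : right c k j = rows c i j := by
  have hk : ∃ i, f i = k := ⟨i, h⟩
  have : hk.choose = i := hf.injective (hk.choose_spec.trans h.symm)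
  simp only [right, Matrix.of_apply, dif_pos hk, this]

theorem right_apply_of_not (c : ParamIdx f → R) {k : Fin n} (h : ¬∃ i, f i = k)
    (j : Fin n) : right c k j = if k = j then 1 else 0 := by
  simp [right, h]

theorem right_blockTriangular (hf : IsPivotWord f) (c : ParamIdx f → R) :
    (right c).BlockTriangular id := by
  intro k j hjk
  by_cases h : ∃ i, f i = k
  · obtain ⟨i, hi⟩ := h
    rw [right_apply hf c hi, rows_apply_of_lt]
    rw [hi]
    exact hjk
  · rw [right_apply_of_not c h]
    exact if_neg (ne_of_gt hjk)

theorem pivotMatrix_mul_apply {i k : Fin n} (h : f i = k) (G : Matrix (Fin n) (Fin n) R)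
    (j : Fin n) : (pivotMatrix f R * G) i j = G k j := by
  simp [Matrix.mul_apply, pivotMatrix, h, Fin.val_inj]

theorem pivotMatrix_mul_apply_of_le {i : Fin n} (h : n ≤ f i) (G : Matrix (Fin n) (Fin n) R)
    (j : Fin n) : (pivotMatrix f R * G) i j = 0 := by
  have : ∀ k : Fin n, f i ≠ k := fun k => by omega
  simp [Matrix.mul_apply, pivotMatrix, this]

theorem mul_pivotMatrix_apply (hf : IsPivotWord f) {i k : Fin n} (h : f i = k)
    (G : Matrix (Fin n) (Fin n) R) (j : Fin n) : (G * pivotMatrix f R) j k = G j i := by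
  simp [Matrix.mul_apply, pivotMatrix, ← h, hf.injective.eq_iff]

theorem mul_pivotMatrix_apply_of_not {k : Fin n} (h : ¬∃ i, f i = k)
    (G : Matrix (Fin n) (Fin n) R) (j : Fin n) : (G * pivotMatrix f R) j k = 0 := by
  push Not at h
  simp [Matrix.mul_apply, pivotMatrix, h]

theorem pivotMatrix_mul_right (hf : IsPivotWord f) (c : ParamIdx f → R) :
    pivotMatrix f R * right c = rows c := by
  ext i j
  rcases lt_or_ge (f i) n with h | h
  · rw [pivotMatrix_mul_apply (f := f) (k := ⟨f i, h⟩) rfl, right_apply hf c rfl]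
  · rw [pivotMatrix_mul_apply_of_le h, rows_apply_of_lt]
    omega

theorem pointX_eq (hf : IsPivotWord f) (c : ParamIdx f → R) :
    pointX c = left c * rows c := by
  rw [pointX, Matrix.mul_assoc, pivotMatrix_mul_right hf]

theorem fiber_apply_of_not (c : ParamIdx f → R) {j k : Fin n}
    (h : ¬((j : ℕ) ≤ f k ∧ ∀ p, f p = j → p ≤ k)) : fiber c j k = 0 := by
  simp [fiber, h]

theorem pivotMatrix_mul_fiber (c : ParamIdx f → R) :
    (pivotMatrix f R * fiber c).BlockTriangular id := by
  intro i j hij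
  rcases lt_or_ge (f i) n with h | h
  · rw [pivotMatrix_mul_apply (f := f) (k := ⟨f i, h⟩) rfl]
    exact fiber_apply_of_not c fun H => not_le.2 hij (H.2 i rfl)
  · exact pivotMatrix_mul_apply_of_le h _ _

theorem fiber_mul_pivotMatrix (hf : IsPivotWord f) (c : ParamIdx f → R) :
    (fiber c * pivotMatrix f R).BlockTriangular id := by
  intro i j hij
  by_cases h : ∃ k, f k = j
  · obtain ⟨k, hk⟩ := h
    rw [mul_pivotMatrix_apply hf hk]
    refine fiber_apply_of_not c fun H => ?_
    have := H.1
    rw [hk] at this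
    exact not_le.2 hij this
  · exact mul_pivotMatrix_apply_of_not h _ _

/-- A matrix `G` such that `π G` and `G π` are upper triangular is of the form `fiber c`. -/
theorem fiber_eq (hf : IsPivotWord f) {G : Matrix (Fin n) (Fin n) R}
    (h₁ : (pivotMatrix f R * G).BlockTriangular id)
    (h₂ : (G * pivotMatrix f R).BlockTriangular id) {c : ParamIdx f → R}
    (hc : ∀ a : FiberIdx f, c (.inr (.inr a)) = G a.1.1 a.1.2) : fiber c = G := by
  ext j k
  by_cases h : (j : ℕ) ≤ f k ∧ ∀ p, f p = j → p ≤ k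
  · simp only [fiber, Matrix.of_apply, dif_pos h, hc]
  · rw [fiber_apply_of_not c h]
    rw [not_and_or, not_le] at h
    rcases h with h | h
    · have hk : f k < n := h.trans j.2
      rw [← mul_pivotMatrix_apply hf (k := ⟨f k, hk⟩) rfl G j]
      exact (h₂ (show (⟨f k, hk⟩ : Fin n) < j from h)).symm
    · push Not at h
      obtain ⟨p, hp, hkp⟩ := h
      rw [← pivotMatrix_mul_apply hp G k]
      exact (h₁ hkp).symm

theorem _root_.Matrix.BlockTriangular.apply_self_ne_zero {m : Type*} [Fintype m] [LinearOrder m]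
    {M : Matrix m m ℂ} (hM : M.BlockTriangular id) (h : IsUnit M.det) (i : m) : M i i ≠ 0 := by
  rw [Matrix.det_of_isUpperTriangular hM, isUnit_iff_ne_zero] at h
  exact Finset.prod_ne_zero_iff.1 h i (Finset.mem_univ i)

theorem _root_.Matrix.BlockTriangular.det_ne_zero {m : Type*} [Fintype m] [LinearOrder m]
    {M : Matrix m m ℂ} (hM : M.BlockTriangular id) (h : ∀ i, M i i ≠ 0) : M.det ≠ 0 := by
  rw [Matrix.det_of_isUpperTriangular hM]
  exact Finset.prod_ne_zero_iff.2 fun i _ => h i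

theorem _root_.Matrix.BlockTriangular.inv_of_isUnit_det {m α : Type*} [Fintype m] [DecidableEq m]
    [LinearOrder α] {b : m → α} {M : Matrix m m ℂ} (hM : M.BlockTriangular b)
    (h : IsUnit M.det) : M⁻¹.BlockTriangular b := by
  have := M.invertibleOfIsUnitDet h
  exact Matrix.blockTriangular_inv_of_blockTriangular hM

theorem _root_.Matrix.BlockTriangular.adjugate {m α : Type*} [Fintype m] [DecidableEq m]
    [LinearOrder α] {b : m → α} {M : Matrix m m ℂ} (hM : M.BlockTriangular b)
    (h : IsUnit M.det) : M.adjugate.BlockTriangular b := by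
  have : M.adjugate = M.det • M⁻¹ := by
    rw [Matrix.inv_def, smul_smul, Ring.mul_inverse_cancel _ h, one_smul]
  intro i j hij
  rw [this, Matrix.smul_apply, hM.inv_of_isUnit_det h hij, smul_zero]

/-- Every invertible upper triangular matrix `U` is of the form `L M⁻¹` with `L` upper unipotent and
supported on the inversions of `f`, and `M` upper triangular with respect to both the usual order
and the order given by `f`. Column `p` of `M` solves a linear system for the principal submatrix of
`U` with indices `i` such that `f i ≤ f p`. -/
theorem exists_factorization (f : Fin n → ℕ) {U : Matrix (Fin n) (Fin n) ℂ}
    (hU : U.BlockTriangular id) (hdet : IsUnit U.det) :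
    ∃ M : Matrix (Fin n) (Fin n) ℂ, IsUnit M.det ∧ M.BlockTriangular id ∧ M.BlockTriangular f ∧
      (U * M).BlockTriangular id ∧
      ∀ i p, f i ≤ f p → (U * M) i p = if i = p then 1 else 0 := by
  let T (p : Fin n) : Matrix {i // f i ≤ f p} {i // f i ≤ f p} ℂ :=
    U.submatrix Subtype.val Subtype.val
  have hT : ∀ p, (T p).BlockTriangular Subtype.val := fun p => hU.submatrix
  have hdiag := Matrix.BlockTriangular.apply_self_ne_zero hU hdet
  have hTu : ∀ p, IsUnit (T p).det := fun p =>
     isUnit_iff_ne_zero.2 (Matrix.BlockTriangular.det_ne_zero (hT p) fun i => hdiag i)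
  let M : Matrix (Fin n) (Fin n) ℂ := Matrix.of fun i p =>
    if h : f i ≤ f p then (T p)⁻¹ ⟨i, h⟩ ⟨p, le_rfl⟩ else 0
  have hMf : M.BlockTriangular f := fun i p h => dif_neg (not_le.2 h)
  have hMid : M.BlockTriangular id := fun i p h => by
    by_cases hi : f i ≤ f p
    · simp only [M, Matrix.of_apply, dif_pos hi]
      exact (hT p).inv_of_isUnit_det (hTu p) (show (⟨p, _⟩ : {i // f i ≤ f p}).1 < i from h)
    · exact dif_neg hi
  have hUM : ∀ i p, f i ≤ f p → (U * M) i p = if i = p then 1 else 0 := fun i p h => by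
    have h1 := congrFun (congrFun (Matrix.mul_nonsing_inv (T p) (hTu p)) ⟨i, h⟩) ⟨p, le_rfl⟩
    rw [Matrix.mul_apply, Matrix.one_apply] at h1
    simp only [Subtype.mk.injEq] at h1
    rw [Matrix.mul_apply, ← h1]
    have h2 : ∀ k : {k // f k ≤ f p}, T p ⟨i, h⟩ k * (T p)⁻¹ k ⟨p, le_rfl⟩ = U i k * M k p :=
      fun k => by simp only [M, Matrix.of_apply, dif_pos k.2]; rfl
    rw [Finset.sum_congr rfl fun k _ => h2 k,
      ← Finset.sum_subtype (Finset.univ.filter fun k => f k ≤ f p) (by simp)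
        fun k => U i k * M k p]
    refine (Finset.sum_subset (Finset.filter_subset _ _) fun k _ hk => ?_).symm
    rw [hMf (not_le.1 (by simpa using hk)), mul_zero]
  have hUMid := hU.mul hMid
  refine ⟨M, ?_, hMid, hMf, hUMid, hUM⟩
  have : (U * M).det = 1 := by
    rw [Matrix.det_of_isUpperTriangular hUMid]
    exact Finset.prod_eq_one fun i _ => by rw [hUM i i le_rfl, if_pos rfl]
  rw [Matrix.det_mul] at this
  exact IsUnit.of_mul_eq_one_right _ this

/-- Every element of the double coset of the partial permutation matrix is in the image of the
parametrization. -/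
theorem exists_left_right (hf : IsPivotWord f) {U W : Matrix (Fin n) (Fin n) ℂ}
    (hU : U.BlockTriangular id) (hUdet : IsUnit U.det)
    (hW : W.BlockTriangular id) (hWdet : IsUnit W.det) :
    ∃ (l : LeftIdx f → ℂ) (r : RightIdx f → ℂ), ∀ g : FiberIdx f → ℂ,
      U * pivotMatrix f ℂ * W = pointX (Sum.elim l (Sum.elim r g)) ∧
      IsUnit (right (Sum.elim l (Sum.elim r g))).det := by
  obtain ⟨M, hMdet, hMid, hMf, hUM, hUMδ⟩ := exists_factorization f hU hUdet
  have hM'id := hMid.inv_of_isUnit_det hMdet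
  have hM'f := hMf.inv_of_isUnit_det hMdet
  have hM'det : IsUnit M⁻¹.det := Matrix.isUnit_nonsing_inv_det M hMdet
  let B : Matrix (Fin n) (Fin n) ℂ := M⁻¹ * (pivotMatrix f ℂ * W)
  have hBdef : ∀ i j, B i j = ∑ p, M⁻¹ i p * (pivotMatrix f ℂ * W) p j := fun _ _ =>
    Matrix.mul_apply
  -- A nonzero term in the entry of `B` at `(i, j)` comes from a pivot `(p, f p)` with
  -- `f i ≤ f p ≤ j`, which is the support condition for `rows`.
  have hterm : ∀ i j p, M⁻¹ i p * (pivotMatrix f ℂ * W) p j ≠ 0 → f i ≤ f p ∧ f p ≤ j := by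
    intro i j p h
    rw [mul_ne_zero_iff] at h
    refine ⟨not_lt.1 fun h' => h.1 (hM'f h'), not_lt.1 fun h' => h.2 ?_⟩
    rcases lt_or_ge (f p) n with hp | hp
    · rw [pivotMatrix_mul_apply (f := f) (k := ⟨f p, hp⟩) rfl]
      exact hW h'
    · exact pivotMatrix_mul_apply_of_le hp _ _
  have hB : ∀ i j : Fin n, ¬ f i ≤ j → B i j = 0 := fun i j hij => by
    rw [hBdef]
    refine Finset.sum_eq_zero fun p _ => ?_
    by_contra h
    exact hij ((hterm i j p h).1.trans (hterm i j p h).2)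
  have hBpivot : ∀ i j : Fin n, f i = j → B i j ≠ 0 := fun i j hij => by
    have : B i j = M⁻¹ i i * W j j := by
      rw [← pivotMatrix_mul_apply hij W j, hBdef]
      refine Finset.sum_eq_single i (fun p _ hp => ?_) fun h => absurd (Finset.mem_univ i) h
      by_contra h
      obtain ⟨h₁, h₂⟩ := hterm i j p h
      exact hp (hf.injective (le_antisymm (hij ▸ h₂) h₁))
    rw [this]
    exact mul_ne_zero (hM'id.apply_self_ne_zero hM'det i) (hW.apply_self_ne_zero hWdet j)
  refine ⟨fun a => (U * M) a.1.1 a.1.2, fun a => B a.1.1 a.1.2, fun g => ?_⟩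
  set c : ParamIdx f → ℂ := Sum.elim _ _
  have hrows : rows c = B := by
    ext i j
    by_cases h : f i ≤ j
    · simp [rows, h, c]
    · rw [rows_apply_of_lt c (not_le.1 h), hB i j h]
  have hleft : left c = U * M := by
    ext i p
    by_cases h : i < p ∧ f p < f i
    · simp [left, h, h.1.ne, c]
    · by_cases hip : i = p
      · subst hip
        rw [left_apply_self, hUMδ i i le_rfl, if_pos rfl]
      · rw [left_apply_of_not c hip h]
        by_cases hlt : i < p
        · rw [hUMδ i p (not_lt.1 fun h' => h ⟨hlt, h'⟩), if_neg hip]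
        · exact (hUM (lt_of_le_of_ne (not_lt.1 hlt) (Ne.symm hip))).symm
  refine ⟨?_, ?_⟩
  · rw [pointX_eq hf, hrows, hleft]
    simp only [B]
    rw [Matrix.mul_assoc U M, ← Matrix.mul_assoc M, Matrix.mul_nonsing_inv M hMdet, Matrix.one_mul,
      Matrix.mul_assoc]
  · refine isUnit_iff_ne_zero.2
      (Matrix.BlockTriangular.det_ne_zero (right_blockTriangular hf c) fun k => ?_)
    by_cases h : ∃ i, f i = k
    · obtain ⟨i, hi⟩ := h
      rw [right_apply hf c hi, hrows]
      exact hBpivot i k hi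
    · simp [right_apply_of_not c h]

end PivotWord

/-! ### Rationality of the inverse of the parametrization -/

namespace MvPolynomial

/-- The functions on the principal open set `D(h)` that are quotients of polynomials in the
components of the polynomial map `φ`, with denominators that vanish nowhere on `D(h)`. -/
def regularAlong {σ K : Type*} (φ : σ → MvPolynomial K ℂ) (h : MvPolynomial K ℂ) :
    Subalgebra ℂ ({x : K → ℂ // eval x h ≠ 0} → ℂ) where
  carrier := {F | ∃ a b : MvPolynomial σ ℂ, ∀ x : {x : K → ℂ // eval x h ≠ 0},
    eval (fun i => eval x.1 (φ i)) b ≠ 0 ∧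
      F x * eval (fun i => eval x.1 (φ i)) b = eval (fun i => eval x.1 (φ i)) a}
  mul_mem' := by
    rintro F G ⟨a, b, hF⟩ ⟨a', b', hG⟩
    refine ⟨a * a', b * b', fun x => ⟨?_, ?_⟩⟩
    · rw [map_mul]
      exact mul_ne_zero (hF x).1 (hG x).1
    · rw [map_mul, map_mul, ← (hF x).2, ← (hG x).2, Pi.mul_apply]
      ring
  add_mem' := by
    rintro F G ⟨a, b, hF⟩ ⟨a', b', hG⟩
    refine ⟨a * b' + a' * b, b * b', fun x => ⟨?_, ?_⟩⟩
    · rw [map_mul]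
      exact mul_ne_zero (hF x).1 (hG x).1
    · rw [map_mul, map_add, map_mul, map_mul, ← (hF x).2, ← (hG x).2, Pi.add_apply]
      ring
  algebraMap_mem' r := ⟨C r, 1, fun x => by simp⟩

variable {σ K : Type*} {φ : σ → MvPolynomial K ℂ} {h : MvPolynomial K ℂ}

theorem eval_mem_regularAlong (i : σ) :
    (fun x : {x : K → ℂ // eval x h ≠ 0} => eval x.1 (φ i)) ∈ regularAlong φ h :=
  ⟨X i, 1, fun x => by simp⟩

/-- Quotients of regular functions by nowhere vanishing ones are regular. -/
theorem mem_regularAlong_of_mul {F G : {x : K → ℂ // eval x h ≠ 0} → ℂ}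
    (hG : G ∈ regularAlong φ h) (hne : ∀ x, G x ≠ 0) (hFG : F * G ∈ regularAlong φ h) :
    F ∈ regularAlong φ h := by
  obtain ⟨a, b, hG⟩ := hG
  obtain ⟨a', b', hFG⟩ := hFG
  refine ⟨a' * b, b' * a, fun x => ⟨?_, ?_⟩⟩
  · rw [map_mul, ← (hG x).2]
    exact mul_ne_zero (hFG x).1 (mul_ne_zero (hne x) (hG x).1)
  · rw [map_mul, map_mul, ← (hG x).2, ← (hFG x).2, Pi.mul_apply]
    ring

/-- Finitely many regular functions have a common denominator. -/
theorem exists_common_denominator [Fintype K]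
    (H : ∀ k, (fun x : {x : K → ℂ // eval x h ≠ 0} => x.1 k) ∈ regularAlong φ h) :
    ∃ (b : MvPolynomial σ ℂ) (a : K → MvPolynomial σ ℂ), ∀ x, eval x h ≠ 0 →
      eval (fun i => eval x (φ i)) b ≠ 0 ∧
      ∀ k, x k * eval (fun i => eval x (φ i)) b = eval (fun i => eval x (φ i)) (a k) := by
  classical
  choose a b hab using H
  refine ⟨∏ k, b k, fun k => a k * ∏ j ∈ Finset.univ.erase k, b j, fun x hx => ⟨?_, fun k => ?_⟩⟩
  · rw [map_prod]
    exact Finset.prod_ne_zero_iff.2 fun k _ => (hab k ⟨x, hx⟩).1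
  · rw [map_mul, ← (hab k ⟨x, hx⟩).2, ← Finset.mul_prod_erase _ _ (Finset.mem_univ k), map_mul]
    ring

end MvPolynomial

namespace PivotWord
open Matrix

variable {n : ℕ} {f : Fin n → ℕ}

/-- The coordinates of the parametrization of the stratum. -/
noncomputable def pointCoords {R : Type*} [CommRing R] (c : ParamIdx f → R) : MatPair.Coord n → R :=
  Sum.elim (fun a => pointX c a.1 a.2) (fun a => pointY c a.1 a.2)

theorem eval_pointCoords (x : ParamIdx f → ℂ) (i : MatPair.Coord n) :
    MvPolynomial.eval x (pointCoords MvPolynomial.X i) = pointCoords x i := by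
  have hx : MvPolynomial.eval x ∘ MvPolynomial.X = x := by
    funext k
    simp
  rcases i with i | i
  · have := map_pointX (MvPolynomial.eval x) (MvPolynomial.X : ParamIdx f → _)
    rw [hx] at this
    exact congrFun (congrFun this i.1) i.2
  · have := map_pointY (MvPolynomial.eval x) (MvPolynomial.X : ParamIdx f → _)
    rw [hx] at this
    exact congrFun (congrFun this i.1) i.2

theorem eval_det_right (x : ParamIdx f → ℂ) :
    MvPolynomial.eval x (right (MvPolynomial.X : ParamIdx f → _)).det = (right x).det := by
  have hx : MvPolynomial.eval x ∘ MvPolynomial.X = x := by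
    funext k
    simp
  rw [RingHom.map_det]
  congr 1
  have := map_right (MvPolynomial.eval x) (MvPolynomial.X : ParamIdx f → _)
  rwa [hx] at this

/-- The domain of the parametrization of the stratum. -/
abbrev Domain (f : Fin n → ℕ) : Type :=
  {x : ParamIdx f → ℂ //
    MvPolynomial.eval x (right (MvPolynomial.X : ParamIdx f → MvPolynomial _ ℂ)).det ≠ 0}

/-- The functions of the parameters that are regular functions of the matrix entries. -/
noncomputable abbrev regular (f : Fin n → ℕ) : Subalgebra ℂ (Domain f → ℂ) :=
  MvPolynomial.regularAlong (pointCoords MvPolynomial.X) (right MvPolynomial.X).det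

theorem det_right_ne_zero (x : Domain f) : (right x.1).det ≠ 0 := by
  rw [← eval_det_right]
  exact x.2

theorem pointX_mem_regular (i j : Fin n) :
    (fun x : Domain f => pointX x.1 i j) ∈ regular f := by
  have := MvPolynomial.eval_mem_regularAlong (φ := pointCoords MvPolynomial.X)
    (h := (right (MvPolynomial.X : ParamIdx f → MvPolynomial _ ℂ)).det) (.inl (i, j))
  simp only [eval_pointCoords] at this
  exact this

theorem pointY_mem_regular (i j : Fin n) :
    (fun x : Domain f => pointY x.1 i j) ∈ regular f := by
  have := MvPolynomial.eval_mem_regularAlong (φ := pointCoords MvPolynomial.X)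
    (h := (right (MvPolynomial.X : ParamIdx f → MvPolynomial _ ℂ)).det) (.inr (i, j))
  simp only [eval_pointCoords] at this
  exact this

theorem const_mem_regular (r : ℂ) : (fun _ : Domain f => r) ∈ regular f :=
  (regular f).algebraMap_mem r

theorem rows_pivot_ne_zero (hf : IsPivotWord f) (x : Domain f) {i j : Fin n} (h : f i = j) :
    rows x.1 i j ≠ 0 := by
  have := det_right_ne_zero x
  rw [Matrix.det_of_isUpperTriangular (right_blockTriangular hf _)] at this
  have := Finset.prod_ne_zero_iff.1 this j (Finset.mem_univ j)
  rwa [right_apply hf _ h] at this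

theorem sum_mem_regular {ι : Type*} (s : Finset ι) {F : ι → Domain f → ℂ}
    (h : ∀ i ∈ s, F i ∈ regular f) : (fun x => ∑ i ∈ s, F i x) ∈ regular f := by
  have := (regular f).sum_mem h
  convert this using 1
  funext x
  rw [Finset.sum_apply]

theorem mul_mem_regular {F G : Domain f → ℂ} (hF : F ∈ regular f) (hG : G ∈ regular f) :
    (fun x => F x * G x) ∈ regular f := (regular f).mul_mem hF hG

theorem left_mul_rows_mem_regular {i p j : Fin n} (hip : p ≠ i)
    (h : i < p → f p < f i → f p ≤ j →
      (fun x : Domain f => left x.1 i p) ∈ regular f ∧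
        (fun x : Domain f => rows x.1 p j) ∈ regular f) :
    (fun x : Domain f => left x.1 i p * rows x.1 p j) ∈ regular f := by
  by_cases h₁ : i < p ∧ f p < f i
  · by_cases h₂ : f p ≤ j
    · exact mul_mem_regular (h h₁.1 h₁.2 h₂).1 (h h₁.1 h₁.2 h₂).2
    · simp only [rows_apply_of_lt _ (not_le.1 h₂), mul_zero]
      exact const_mem_regular 0
  · simp only [left_apply_of_not _ hip.symm h₁, zero_mul]
    exact const_mem_regular 0

/-- The entry of `X = L (π R)` at `(i, j)` is the entry of `π R` at `(i, j)`, or a multiple by a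
nonzero pivot of the entry of `L` in row `i` for the pivot in column `j`, plus terms that involve
only entries attached to positions below or to the left of `(i, j)`. So the entries of the two
factors are determined recursively as rational functions of `X`, from the lower left corner on. -/
theorem rows_left_mem_regular (hf : IsPivotWord f) (m : ℕ) :
    (∀ i j : Fin n, (n - i) + j = m → (fun x : Domain f => rows x.1 i j) ∈ regular f) ∧
    (∀ i p : Fin n, (n - i) + f p = m → (fun x : Domain f => left x.1 i p) ∈ regular f) := by
  induction m using Nat.strong_induction_on with
  | _ m ih =>
    constructor
    · intro i j hij
      by_cases h : f i ≤ j
      · have hX : (fun x : Domain f => rows x.1 i j) = (fun x => pointX x.1 i j) -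
            fun x => ∑ p ∈ Finset.univ.erase i, left x.1 i p * rows x.1 p j := by
          funext x
          rw [Pi.sub_apply, pointX_eq hf, Matrix.mul_apply,
            ← Finset.add_sum_erase _ _ (Finset.mem_univ i), left_apply_self]
          ring
        rw [hX]
        refine (regular f).sub_mem (pointX_mem_regular i j) (sum_mem_regular _ fun p hp => ?_)
        refine left_mul_rows_mem_regular (Finset.ne_of_mem_erase hp) fun h₁ h₂ h₃ => ?_
        have : (i : ℕ) < p := h₁
        exact ⟨(ih _ (by omega)).2 i p rfl, (ih _ (by omega)).1 p j rfl⟩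
      · simp only [rows_apply_of_lt _ (not_le.1 h)]
        exact const_mem_regular 0
    · intro i p hip
      by_cases h : i < p ∧ f p < f i
      · have hlt : (i : ℕ) < p := h.1
        have hpn : f p < n := by
          by_contra hp
          have h₁ := hf.eq_add p (not_lt.1 hp)
          have h₂ := hf.eq_add i ((not_lt.1 hp).trans h.2.le)
          omega
        obtain ⟨j, hj⟩ : ∃ j : Fin n, f p = j := ⟨⟨f p, hpn⟩, rfl⟩
        refine MvPolynomial.mem_regularAlong_of_mul (G := fun x : Domain f => rows x.1 p j)
          ((ih _ (by omega)).1 p j rfl) (fun x => rows_pivot_ne_zero hf x hj) ?_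
        have hX : ((fun x : Domain f => left x.1 i p) * fun x : Domain f => rows x.1 p j) =
            (fun x => pointX x.1 i j) -
            fun x => ∑ q ∈ Finset.univ.erase p, left x.1 i q * rows x.1 q j := by
          funext x
          rw [Pi.sub_apply, pointX_eq hf, Matrix.mul_apply,
            ← Finset.add_sum_erase _ _ (Finset.mem_univ p), Pi.mul_apply]
          ring
        rw [hX]
        refine (regular f).sub_mem (pointX_mem_regular i j) (sum_mem_regular _ fun q hq => ?_)
        by_cases hqi : q = i
        · subst hqi
          simp only [rows_apply_of_lt _ (hj ▸ h.2), mul_zero]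
          exact const_mem_regular 0
        · refine left_mul_rows_mem_regular hqi fun h₁ h₂ h₃ => ?_
          have : (i : ℕ) < q := h₁
          have : f q ≠ f p := fun h' => Finset.ne_of_mem_erase hq (hf.injective h')
          exact ⟨(ih _ (by omega)).2 i q rfl, (ih _ (by omega)).1 q j rfl⟩
      · by_cases hip : i = p
        · subst hip
          simp only [left_apply_self]
          exact const_mem_regular 1
        · simp only [left_apply_of_not _ hip h]
          exact const_mem_regular 0

theorem rows_mem_regular (hf : IsPivotWord f) (i j : Fin n) :
    (fun x : Domain f => rows x.1 i j) ∈ regular f :=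
  (rows_left_mem_regular hf _).1 i j rfl

theorem left_mem_regular (hf : IsPivotWord f) (i p : Fin n) :
    (fun x : Domain f => left x.1 i p) ∈ regular f :=
  (rows_left_mem_regular hf _).2 i p rfl

theorem right_mem_regular (hf : IsPivotWord f) (k j : Fin n) :
    (fun x : Domain f => right x.1 k j) ∈ regular f := by
  by_cases h : ∃ i, f i = k
  · obtain ⟨i, hi⟩ := h
    simp only [right_apply hf _ hi]
    exact rows_mem_regular hf i j
  · simp only [right_apply_of_not _ h]
    exact const_mem_regular _

theorem det_right_mem_regular (hf : IsPivotWord f) :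
    (fun x : Domain f => (right x.1).det) ∈ regular f := by
  have : (fun x : Domain f => (right x.1).det) = ∏ k, fun x : Domain f => right x.1 k k := by
    funext x
    rw [Matrix.det_of_isUpperTriangular (right_blockTriangular hf _), Finset.prod_apply]
  rw [this]
  exact (regular f).prod_mem fun k _ => right_mem_regular hf k k

/-- The fiber coordinates are recovered from `Y` and the two triangular factors. -/
theorem mul_pointY_mul (x : Domain f) :
    right x.1 * pointY x.1 * left x.1 = (right x.1).det • fiber x.1 := by
  have h₁ := Matrix.mul_adjugate (right x.1)
  have h₂ := Matrix.adjugate_mul (left x.1)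
  rw [det_left, one_smul] at h₂
  rw [pointY, Matrix.mul_assoc, Matrix.mul_assoc, h₂, Matrix.mul_one, ← Matrix.mul_assoc, h₁,
    Matrix.smul_mul, Matrix.one_mul]

theorem fiber_mem_regular (hf : IsPivotWord f) (i j : Fin n) :
    (fun x : Domain f => fiber x.1 i j) ∈ regular f := by
  refine MvPolynomial.mem_regularAlong_of_mul (det_right_mem_regular hf) det_right_ne_zero ?_
  have : ((fun x : Domain f => fiber x.1 i j) * fun x : Domain f => (right x.1).det) =
      fun x : Domain f => ∑ k, (∑ l, right x.1 i l * pointY x.1 l k) * left x.1 k j := by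
    funext x
    have := congrFun (congrFun (mul_pointY_mul x) i) j
    rw [Matrix.mul_apply, Matrix.smul_apply, smul_eq_mul] at this
    simp only [Matrix.mul_apply] at this
    rw [Pi.mul_apply, this, mul_comm]
  rw [this]
  exact sum_mem_regular _ fun k _ => mul_mem_regular
    (sum_mem_regular _ fun l _ => mul_mem_regular (right_mem_regular hf i l)
      (pointY_mem_regular l k)) (left_mem_regular hf k j)

theorem param_mem_regular (hf : IsPivotWord f) (k : ParamIdx f) :
    (fun x : Domain f => x.1 k) ∈ regular f := by
  rcases k with ⟨⟨i, p⟩, h⟩ | ⟨⟨i, j⟩, h⟩ | ⟨⟨j, k⟩, h⟩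
  · convert left_mem_regular hf i p using 2 with x
    simp [left, h, h.1.ne]
  · convert rows_mem_regular hf i j using 2 with x
    simp only [rows, Matrix.of_apply, dif_pos h]
  · convert fiber_mem_regular hf j k using 2 with x
    simp only [fiber, Matrix.of_apply, dif_pos h]

end PivotWord

/-! ### The chart of a stratum and its dimension -/

section Borel
open Matrix
variable {n : ℕ}

theorem mul_mem_upperBorel {U W : GL (Fin n) ℂ} (hU : U ∈ upperBorel n) (hW : W ∈ upperBorel n) :
    U * W ∈ upperBorel n :=
  Matrix.BlockTriangular.mul hU hW

theorem isUnit_det_coe (U : GL (Fin n) ℂ) : IsUnit (U : Matrix (Fin n) (Fin n) ℂ).det :=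
  (Matrix.isUnit_iff_isUnit_det _).1 U.isUnit

theorem inv_mem_upperBorel {U : GL (Fin n) ℂ} (hU : U ∈ upperBorel n) : U⁻¹ ∈ upperBorel n := by
  change ((U⁻¹ : GL (Fin n) ℂ) : Matrix (Fin n) (Fin n) ℂ).BlockTriangular id
  rw [Matrix.coe_units_inv]
  exact Matrix.BlockTriangular.inv_of_isUnit_det hU (isUnit_det_coe U)

/-- An invertible upper triangular matrix, as an element of the Borel subgroup. -/
theorem exists_mem_upperBorel {M : Matrix (Fin n) (Fin n) ℂ} (hM : M.BlockTriangular id)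
    (h : M.det ≠ 0) : ∃ U ∈ upperBorel n, (U : Matrix (Fin n) (Fin n) ℂ) = M :=
  ⟨Matrix.GeneralLinearGroup.mkOfDetNeZero M h, hM, rfl⟩

end Borel

namespace PivotWord
open Matrix

variable {n : ℕ} {f : Fin n → ℕ}

/-- The parametrization maps its domain onto the stratum. -/
theorem mem_stratum_iff (hf : IsPivotWord f) (P : MatPair n) :
    P ∈ stratum (pivotMatrix f ℂ) ↔
      ∃ x, MvPolynomial.eval x (right (MvPolynomial.X : ParamIdx f → _)).det ≠ 0 ∧
        ∀ i, P.coords i = MvPolynomial.eval x (pointCoords MvPolynomial.X i) := by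
  simp only [eval_pointCoords, eval_det_right]
  constructor
  · rintro ⟨⟨hXY, hYX⟩, U, hU, W, hW, hX⟩
    obtain ⟨l, r, hlr⟩ := exists_left_right hf hU (isUnit_det_coe U) (inv_mem_upperBorel hW)
      (isUnit_det_coe W⁻¹)
    have hXl : ∀ g, P.X = pointX (Sum.elim l (Sum.elim r g)) := fun g => hX.trans (hlr g).1
    let A : Matrix (Fin n) (Fin n) ℂ := left (Sum.elim l (Sum.elim r (0 : FiberIdx f → ℂ)))
    let B : Matrix (Fin n) (Fin n) ℂ := right (Sum.elim l (Sum.elim r (0 : FiberIdx f → ℂ)))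
    have hA : ∀ g, left (Sum.elim l (Sum.elim r g)) = A := fun g => rfl
    have hB : ∀ g, right (Sum.elim l (Sum.elim r g)) = B := fun g => rfl
    have hBdet : IsUnit B.det := (hlr 0).2
    have hAdet : A.det = 1 := det_left _
    have hXAB : P.X = A * pivotMatrix f ℂ * B := hXl 0
    let G : Matrix (Fin n) (Fin n) ℂ := B.det⁻¹ • (B * P.Y * A)
    have hAA : A⁻¹ * A = 1 := Matrix.nonsing_inv_mul A (by simp [hAdet])
    have hBB : B * B⁻¹ = 1 := Matrix.mul_nonsing_inv B hBdet
    have hAt : A.BlockTriangular id := left_blockTriangular _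
    have hBt : B.BlockTriangular id := right_blockTriangular hf _
    have h₁ : (pivotMatrix f ℂ * G).BlockTriangular id := by
      have : pivotMatrix f ℂ * G = B.det⁻¹ • (A⁻¹ * (P.X * P.Y) * A) := by
        simp only [G, hXAB, Matrix.mul_smul]
        congr 1
        simp only [← Matrix.mul_assoc, hAA, Matrix.one_mul]
      intro i j hij
      rw [this, Matrix.smul_apply,
        ((hAt.inv_of_isUnit_det (by simp [hAdet])).mul hXY).mul hAt hij, smul_zero]
    have h₂ : (G * pivotMatrix f ℂ).BlockTriangular id := by
      have : G * pivotMatrix f ℂ = B.det⁻¹ • (B * (P.Y * P.X) * B⁻¹) := by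
        simp only [G, hXAB, Matrix.smul_mul]
        congr 1
        simp only [Matrix.mul_assoc, hBB, Matrix.mul_one]
      intro i j hij
      rw [this, Matrix.smul_apply,
        (hBt.mul hYX).mul (hBt.inv_of_isUnit_det hBdet) hij, smul_zero]
    let g : FiberIdx f → ℂ := fun a => G a.1.1 a.1.2
    have hG : fiber (Sum.elim l (Sum.elim r g)) = G := fiber_eq hf h₁ h₂ fun a => rfl
    refine ⟨Sum.elim l (Sum.elim r g), (hlr g).2.ne_zero, ?_⟩
    have hY : P.Y = pointY (Sum.elim l (Sum.elim r g)) := by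
      have h₃ : A * A.adjugate = 1 := by rw [Matrix.mul_adjugate, hAdet, one_smul]
      rw [pointY, hG, hA, hB]
      simp only [G, Matrix.mul_smul, Matrix.smul_mul]
      rw [← Matrix.mul_assoc, ← Matrix.mul_assoc, Matrix.adjugate_mul, Matrix.mul_assoc, h₃,
        Matrix.mul_one, Matrix.smul_mul, Matrix.one_mul, smul_smul,
        inv_mul_cancel₀ hBdet.ne_zero, one_smul]
    rintro (a | a)
    · exact congrFun (congrFun (hXl g) a.1) a.2
    · exact congrFun (congrFun hY a.1) a.2
  · rintro ⟨x, hx, hP⟩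
    have hX : P.X = pointX x := by
      ext i j
      exact hP (.inl (i, j))
    have hY : P.Y = pointY x := by
      ext i j
      exact hP (.inr (i, j))
    have hAt := left_blockTriangular x
    have hBt := right_blockTriangular hf x
    have hAdet : IsUnit (left x).det := by simp [det_left]
    have hBdet : IsUnit (right x).det := isUnit_iff_ne_zero.2 hx
    refine ⟨⟨?_, ?_⟩, ?_⟩
    · have : P.X * P.Y = (right x).det •
          (left x * (pivotMatrix f ℂ * fiber x) * (left x).adjugate) := by
        rw [hX, hY, pointX, pointY]
        calc _ = left x * pivotMatrix f ℂ * (right x * (right x).adjugate) * fiber x *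
              (left x).adjugate := by simp only [Matrix.mul_assoc]
          _ = _ := by simp [Matrix.mul_adjugate, Matrix.mul_assoc]
      intro i j hij
      rw [this, Matrix.smul_apply, (hAt.mul (pivotMatrix_mul_fiber x)).mul (hAt.adjugate hAdet) hij,
        smul_zero]
    · have : P.Y * P.X = (right x).adjugate * (fiber x * pivotMatrix f ℂ) * right x := by
        rw [hX, hY, pointX, pointY]
        calc _ = (right x).adjugate * fiber x * ((left x).adjugate * left x) * pivotMatrix f ℂ *
              right x := by simp only [Matrix.mul_assoc]
          _ = _ := by simp [Matrix.adjugate_mul, det_left, Matrix.mul_assoc]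
      rw [this]
      exact ((hBt.adjugate hBdet).mul (fiber_mul_pivotMatrix hf x)).mul hBt
    · obtain ⟨U, hU, hUA⟩ := exists_mem_upperBorel hAt hAdet.ne_zero
      obtain ⟨W, hW, hWB⟩ := exists_mem_upperBorel hBt hx
      exact ⟨U, hU, W⁻¹, inv_mem_upperBorel hW, by rw [hX, actMat, inv_inv, hUA, hWB, pointX]⟩

/-- At the parameters that are all `1`, the right factor is upper triangular with ones on the
diagonal. -/
theorem det_right_X_ne_zero (hf : IsPivotWord f) :
    (right (MvPolynomial.X : ParamIdx f → MvPolynomial _ ℂ)).det ≠ 0 := by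
  intro h0
  have := eval_det_right (fun _ : ParamIdx f => (1 : ℂ))
  rw [h0, map_zero, Matrix.det_of_isUpperTriangular (right_blockTriangular hf _)] at this
  refine Finset.prod_ne_zero_iff.2 (fun k _ => ?_) this.symm
  by_cases h : ∃ i, f i = k
  · obtain ⟨i, hi⟩ := h
    rw [right_apply hf _ hi]
    simp [rows, hi]
  · simp [right_apply_of_not _ h]

/-- The stratum of a partial permutation matrix has a rational chart. -/
theorem exists_rationalChart (hf : IsPivotWord f) :
    Nonempty (MatPair.RationalChart (ParamIdx f) (stratum (pivotMatrix f ℂ))) := by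
  obtain ⟨b, a, hab⟩ := MvPolynomial.exists_common_denominator (param_mem_regular hf)
  exact ⟨⟨pointCoords MvPolynomial.X, (right MvPolynomial.X).det, det_right_X_ne_zero hf,
    mem_stratum_iff hf, b, a, fun x hx => (hab x hx).1, fun x hx => (hab x hx).2⟩⟩

open scoped ComplexOrder in
/-- The rank of `π` is that of `π πᴴ`, the diagonal projection to the nonzero rows. -/
theorem rank_pivotMatrix (hf : IsPivotWord f) :
    (pivotMatrix f ℂ).rank = Fintype.card {i // f i < n} := by
  have : pivotMatrix f ℂ * (pivotMatrix f ℂ)ᴴ =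
      Matrix.diagonal fun i => if f i < n then 1 else 0 := by
    ext i j
    rw [Matrix.diagonal_apply]
    rcases lt_or_ge (f i) n with h | h
    · rw [pivotMatrix_mul_apply (f := f) (k := ⟨f i, h⟩) rfl, Matrix.conjTranspose_apply]
      simp [pivotMatrix, hf.injective.eq_iff, h, eq_comm, apply_ite]
    · rw [pivotMatrix_mul_apply_of_le h]
      simp [not_lt.2 h]
  rw [← Matrix.rank_self_mul_conjTranspose, this, Matrix.rank_diagonal]
  exact Fintype.card_congr (Equiv.subtypeEquivRight fun i => by simp)

/-- The positions that are not free in the fiber correspond to the pairs `(k, j)` with `f k < j`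
and to the inversions of the word. -/
theorem card_not_fiberIdx (hf : IsPivotWord f) :
    Fintype.card {a : Fin n × Fin n //
      ¬((a.1 : ℕ) ≤ f a.2 ∧ ∀ p, f p = a.1 → p ≤ a.2)} =
    Fintype.card {a : Fin n × Fin n // f a.1 < a.2} + Fintype.card (LeftIdx f) := by
  have hlt : ∀ a : LeftIdx f, f a.1.2 < n := fun a => by
    by_contra hp
    have h₁ := hf.eq_add a.1.2 (not_lt.1 hp)
    have h₂ := hf.eq_add a.1.1 ((not_lt.1 hp).trans a.2.2.le)
    have h₃ : (a.1.1 : ℕ) < a.1.2 := a.2.1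
    have := a.2.2
    omega
  rw [← Fintype.card_sum]
  refine (Fintype.card_congr (Equiv.ofBijective (Sum.elim
    (fun a => ⟨(a.1.2, a.1.1), fun h => not_le.2 a.2 h.1⟩)
    (fun a => ⟨(⟨f a.1.2, hlt a⟩, a.1.1), fun h => not_le.2 a.2.1 (h.2 _ rfl)⟩)) ⟨?_, ?_⟩)).symm
  · rintro (⟨⟨k, j⟩, h⟩ | ⟨⟨k, p⟩, h⟩) (⟨⟨k', j'⟩, h'⟩ | ⟨⟨k', p'⟩, h'⟩) he
    · simp only [Sum.elim_inl, Subtype.mk.injEq, Prod.mk.injEq] at he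
      simp [he]
    · simp only [Sum.elim_inl, Sum.elim_inr, Subtype.mk.injEq, Prod.mk.injEq] at he
      obtain ⟨rfl, rfl⟩ := he
      exact absurd h'.2 (lt_asymm h)
    · simp only [Sum.elim_inl, Sum.elim_inr, Subtype.mk.injEq, Prod.mk.injEq] at he
      obtain ⟨rfl, rfl⟩ := he
      exact absurd h.2 (lt_asymm h')
    · simp only [Sum.elim_inr, Subtype.mk.injEq, Prod.mk.injEq, Fin.mk.injEq] at he
      obtain ⟨he, rfl⟩ := he
      obtain rfl := hf.injective he
      rfl
  · rintro ⟨⟨j, k⟩, h⟩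
    by_cases hk : f k < j
    · exact ⟨.inl ⟨(k, j), hk⟩, rfl⟩
    · have : ∃ p, f p = j ∧ k < p := by
        by_contra! H
        exact h ⟨not_lt.1 hk, H⟩
      obtain ⟨p, hp, hkp⟩ := this
      have hne : f p ≠ f k := fun h' => hkp.ne' (hf.injective h')
      have hpk : f p < f k := by
        have := not_lt.1 hk
        omega
      exact ⟨.inr ⟨(k, p), hkp, hpk⟩, Subtype.ext (Prod.ext (Fin.ext hp) rfl)⟩

theorem card_rightIdx (f : Fin n → ℕ) :
    Fintype.card (RightIdx f) =
      Fintype.card {a : Fin n × Fin n // f a.1 < a.2} + Fintype.card {i // f i < n} := by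
  have h₁ : Fintype.card {i // f i < n} = Fintype.card {a : Fin n × Fin n // f a.1 = a.2} :=
    Fintype.card_congr
      { toFun := fun i => ⟨(i.1, ⟨f i.1, i.2⟩), rfl⟩
        invFun := fun a => ⟨a.1.1, a.2 ▸ a.1.2.2⟩
        left_inv := fun i => rfl
        right_inv := fun a => Subtype.ext (Prod.ext rfl (Fin.ext a.2)) }
  rw [h₁, ← Fintype.card_subtype_or_disjoint]
  · exact Fintype.card_congr (Equiv.subtypeEquivRight fun a => le_iff_lt_or_eq)
  · rw [Pi.disjoint_iff]
    intro a
    rw [Prop.disjoint_iff]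
    rintro ⟨h, h'⟩
    exact h.ne h'

theorem card_paramIdx (hf : IsPivotWord f) :
    Fintype.card (ParamIdx f) = n ^ 2 + (pivotMatrix f ℂ).rank := by
  have h₁ := card_not_fiberIdx hf
  have h₂ := card_rightIdx f
  have h₃ : Fintype.card {a : Fin n × Fin n //
      ¬((a.1 : ℕ) ≤ f a.2 ∧ ∀ p, f p = a.1 → p ≤ a.2)} = n * n - Fintype.card (FiberIdx f) := by
    rw [Fintype.card_subtype_compl, Fintype.card_prod, Fintype.card_fin]
  have h₄ : Fintype.card (FiberIdx f) ≤ n * n := by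
    simpa using Fintype.card_subtype_le
      fun a : Fin n × Fin n => (a.1 : ℕ) ≤ f a.2 ∧ ∀ p, f p = a.1 → p ≤ a.2
  rw [Fintype.card_sum, Fintype.card_sum, rank_pivotMatrix hf, sq]
  omega

/-- Every partial permutation matrix is encoded by a word. -/
theorem exists_isPivotWord {π : Matrix (Fin n) (Fin n) ℂ} (hπ : IsPartialPermMatrix π) :
    ∃ f, IsPivotWord f ∧ π = pivotMatrix f ℂ := by
  classical
  obtain ⟨h01, hrow, hcol⟩ := hπ
  let f : Fin n → ℕ := fun i => if h : ∃ j, π i j = 1 then h.choose else n + i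
  have hf1 : ∀ i (j : Fin n), f i = j ↔ π i j = 1 := by
    intro i j
    by_cases h : ∃ j, π i j = 1
    · simp only [f, dif_pos h, Fin.val_inj]
      exact ⟨fun hj => hj ▸ h.choose_spec, fun hj => hrow i _ _ h.choose_spec hj⟩
    · simp only [f, dif_neg h]
      exact ⟨fun hj => by omega, fun hj => absurd ⟨j, hj⟩ h⟩
  have hf2 : ∀ i, n ≤ f i → f i = n + i := by
    intro i hi
    by_cases h : ∃ j, π i j = 1
    · simp only [f, dif_pos h] at hi
      omega
    · simp only [f, dif_neg h]
  refine ⟨f, ⟨fun i i' h => ?_, hf2⟩, ?_⟩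
  · rcases lt_or_ge (f i) n with hi | hi
    · exact hcol i i' ⟨f i, hi⟩ ((hf1 _ _).1 rfl) ((hf1 _ _).1 h.symm)
    · have h₁ := hf2 i hi
      have h₂ := hf2 i' (h ▸ hi)
      exact Fin.ext (by omega)
  · ext i j
    simp only [pivotMatrix, Matrix.of_apply, hf1]
    split_ifs with h
    · exact h
    · exact (h01 i j).resolve_right h

end PivotWord

/-! ### Torus orbits in the strata of permutation matrices -/

section Triangular
open Matrix
variable {n : ℕ}

theorem Matrix.BlockTriangular.mul_apply_self {M N : Matrix (Fin n) (Fin n) ℂ}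
    (hM : M.BlockTriangular id) (hN : N.BlockTriangular id) (i : Fin n) :
    (M * N) i i = M i i * N i i := by
  rw [Matrix.mul_apply]
  refine Finset.sum_eq_single i (fun k _ hk => ?_) fun h => absurd (Finset.mem_univ i) h
  rcases lt_or_gt_of_ne hk with h | h
  · rw [hM (show id k < id i from h), zero_mul]
  · rw [hN (show id i < id k from h), mul_zero]

/-- Conjugation by an invertible upper triangular matrix preserves the diagonal of an upper
triangular matrix. -/
theorem Matrix.BlockTriangular.inv_mul_mul_apply_self {U M : Matrix (Fin n) (Fin n) ℂ}
    (hU : U.BlockTriangular id) (hdet : IsUnit U.det) (hM : M.BlockTriangular id) (i : Fin n) :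
    (U⁻¹ * M * U) i i = M i i := by
  have hU' := hU.inv_of_isUnit_det hdet
  have h : U⁻¹ i i * U i i = 1 := by
    rw [← hU'.mul_apply_self hU, Matrix.nonsing_inv_mul U hdet, Matrix.one_apply_eq]
  rw [(hU'.mul hM).mul_apply_self hU, hU'.mul_apply_self hM, mul_right_comm, h, one_mul]

theorem Matrix.BlockTriangular.aeval {b : Fin n → Fin n} {M : Matrix (Fin n) (Fin n) ℂ}
    (hM : M.BlockTriangular b) (p : Polynomial ℂ) : (Polynomial.aeval M p).BlockTriangular b := by
  induction p using Polynomial.induction_on' with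
  | add p q hp hq =>
    rw [map_add]
    exact hp.add hq
  | monomial k r =>
    rw [Polynomial.aeval_monomial]
    exact (Matrix.blockTriangular_algebraMap r).mul (hM.pow k)

theorem Matrix.BlockTriangular.aeval_apply_self {M : Matrix (Fin n) (Fin n) ℂ}
    (hM : M.BlockTriangular id) (p : Polynomial ℂ) (i : Fin n) :
    (Polynomial.aeval M p) i i = p.eval (M i i) := by
  have hpow : ∀ k : ℕ, (M ^ k) i i = M i i ^ k := fun k => by
    induction k with
    | zero => simp
    | succ k ih => rw [pow_succ, (hM.pow k).mul_apply_self hM, ih, pow_succ]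
  induction p using Polynomial.induction_on' with
  | add p q hp hq => rw [map_add, Matrix.add_apply, hp, hq, Polynomial.eval_add]
  | monomial k r =>
    rw [Polynomial.aeval_monomial, Polynomial.eval_monomial,
      (Matrix.blockTriangular_algebraMap r).mul_apply_self (hM.pow k), hpow]
    simp [Matrix.algebraMap_matrix_apply]

/-- An upper triangular matrix `M` with pairwise distinct diagonal entries is diagonalized by an
upper triangular matrix, which is triangular with respect to every other order for which `M` is.
Its column `j` is column `j` of `∏ (M - M k k)`, the product over all `k ≠ j`; this is an
eigenvector by the Cayley-Hamilton theorem. -/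
theorem exists_diagonalization {M : Matrix (Fin n) (Fin n) ℂ} (hM : M.BlockTriangular id)
    (hd : Function.Injective fun i => M i i) :
    ∃ T : Matrix (Fin n) (Fin n) ℂ,
      (∀ b : Fin n → Fin n, M.BlockTriangular b → T.BlockTriangular b) ∧
      (∀ i, T i i ≠ 0) ∧ M * T = T * Matrix.diagonal fun i => M i i := by
  let l (j : Fin n) : Polynomial ℂ :=
    ∏ k ∈ Finset.univ.erase j, (Polynomial.X - Polynomial.C (M k k))
  let T : Matrix (Fin n) (Fin n) ℂ := Matrix.of fun i j => Polynomial.aeval M (l j) i j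
  refine ⟨T, fun b hb i j hij => hb.aeval (l j) hij, fun i => ?_, ?_⟩
  · change Polynomial.aeval M (l i) i i ≠ 0
    rw [Matrix.BlockTriangular.aeval_apply_self hM, Polynomial.eval_prod]
    refine Finset.prod_ne_zero_iff.2 fun k hk => ?_
    rw [Polynomial.eval_sub, Polynomial.eval_X, Polynomial.eval_C, sub_ne_zero]
    exact fun h => Finset.ne_of_mem_erase hk (hd h).symm
  · ext i j
    have h₁ : (Polynomial.X - Polynomial.C (M j j)) * l j = M.charpoly := by
      rw [Matrix.charpoly_of_isUpperTriangular M hM]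
      exact Finset.mul_prod_erase _ (fun k => Polynomial.X - Polynomial.C (M k k))
        (Finset.mem_univ j)
    have h₂ := congrArg (Polynomial.aeval M) h₁
    rw [Matrix.aeval_self_charpoly, map_mul, map_sub, Polynomial.aeval_X, Polynomial.aeval_C,
      sub_mul, sub_eq_zero, ← Algebra.smul_def] at h₂
    have h₃ := congrFun (congrFun h₂ i) j
    rw [Matrix.smul_apply, smul_eq_mul] at h₃
    rw [Matrix.mul_diagonal, mul_comm]
    exact h₃

/-- An invertible upper triangular matrix is the product of an upper unipotent and an invertible
diagonal matrix. -/
theorem exists_unipotent_mul_diagonal {U : GL (Fin n) ℂ} (hU : U ∈ upperBorel n) :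
    ∃ N ∈ upperUnipotent n, ∃ t : Fin n → ℂ, (∀ i, t i ≠ 0) ∧
      (U : Matrix (Fin n) (Fin n) ℂ) = N * Matrix.diagonal t := by
  let t : Fin n → ℂ := fun i => (U : Matrix (Fin n) (Fin n) ℂ) i i
  have ht : ∀ i, t i ≠ 0 := fun i =>
    Matrix.BlockTriangular.apply_self_ne_zero (M := (U : Matrix (Fin n) (Fin n) ℂ)) hU
      (isUnit_det_coe U) i
  let M : Matrix (Fin n) (Fin n) ℂ := U * Matrix.diagonal fun i => (t i)⁻¹
  have hM : M.BlockTriangular id := Matrix.BlockTriangular.mul hU (blockTriangular_diagonal _)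
  have hd : ∀ i, M i i = 1 := fun i => by
    simp only [M, Matrix.mul_diagonal]
    exact mul_inv_cancel₀ (ht i)
  obtain ⟨N, hN, hNM⟩ := exists_mem_upperBorel hM
    (Matrix.BlockTriangular.det_ne_zero hM fun i => by rw [hd]; exact one_ne_zero)
  refine ⟨N, ⟨hN, fun i => by rw [hNM, hd]⟩, t, ht, ?_⟩
  rw [hNM, Matrix.mul_assoc, Matrix.diagonal_mul_diagonal]
  simp [ht]

end Triangular

section Generic
open Matrix
variable {n : ℕ} (σ : Equiv.Perm (Fin n))

theorem permMatrix_mul_apply (G : Matrix (Fin n) (Fin n) ℂ) (i j : Fin n) :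
    (σ.permMatrix ℂ * G) i j = G (σ i) j := by
  rw [Equiv.Perm.permMatrix, PEquiv.toMatrix_toPEquiv_mul]
  rfl

theorem mul_permMatrix_apply (G : Matrix (Fin n) (Fin n) ℂ) (i j : Fin n) :
    (G * σ.permMatrix ℂ) i j = G i (σ.symm j) := by
  rw [Equiv.Perm.permMatrix, PEquiv.mul_toMatrix_toPEquiv]
  rfl

theorem isUnit_det_permMatrix : IsUnit (σ.permMatrix ℂ).det := by
  rw [Matrix.det_permutation, isUnit_iff_ne_zero]
  simp

theorem diagonal_mul_permMatrix (t : Fin n → ℂ) :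
    Matrix.diagonal t * σ.permMatrix ℂ =
      σ.permMatrix ℂ * Matrix.diagonal (fun i => t (σ.symm i)) := by
  ext i j
  rw [mul_permMatrix_apply, permMatrix_mul_apply, Matrix.diagonal_apply, Matrix.diagonal_apply]
  by_cases h : i = σ.symm j
  · simp [h]
  · have : σ i ≠ j := fun h' => h (by simp [← h'])
    simp [h, this]

theorem permMatrix_mul_diagonal (t : Fin n → ℂ) :
    σ.permMatrix ℂ * Matrix.diagonal t =
      Matrix.diagonal (fun i => t (σ i)) * σ.permMatrix ℂ := by
  rw [diagonal_mul_permMatrix]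
  simp

theorem actPair_torusPoint_X_mul_Y (U W : GL (Fin n) ℂ) (s t : Fin n → ℂ) :
    (actPair U W (torusPoint (σ.permMatrix ℂ) s t)).X *
      (actPair U W (torusPoint (σ.permMatrix ℂ) s t)).Y =
        U * Matrix.diagonal (fun i => t (σ i) * s (σ i)) *
          ((U⁻¹ : GL (Fin n) ℂ) : Matrix (Fin n) (Fin n) ℂ) := by
  set π := σ.permMatrix ℂ
  have hππ : π * π⁻¹ = 1 := Matrix.mul_nonsing_inv π (isUnit_det_permMatrix σ)
  have hWW : ((W⁻¹ : GL (Fin n) ℂ) : Matrix (Fin n) (Fin n) ℂ) * W = 1 := W.inv_mul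
  simp only [actPair, actMat, torusPoint]
  calc _ = U * (π * diagonal t) * (((W⁻¹ : GL (Fin n) ℂ) : Matrix (Fin n) (Fin n) ℂ) * W) *
        diagonal s * π⁻¹ * ((U⁻¹ : GL (Fin n) ℂ) : Matrix (Fin n) (Fin n) ℂ) := by
          simp only [Matrix.mul_assoc]
    _ = U * (π * (diagonal t * diagonal s)) * π⁻¹ *
          ((U⁻¹ : GL (Fin n) ℂ) : Matrix (Fin n) (Fin n) ℂ) := by
          rw [hWW, Matrix.mul_one]; simp only [Matrix.mul_assoc]
    _ = _ := by
      rw [Matrix.diagonal_mul_diagonal, permMatrix_mul_diagonal, Matrix.mul_assoc _ _ π⁻¹,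
        Matrix.mul_assoc _ π, hππ, Matrix.mul_one]

theorem torusOrbits_subset_stratum :
    torusOrbits (σ.permMatrix ℂ) ⊆ stratum (σ.permMatrix ℂ) := by
  rintro _ ⟨s, t, hs, ht, U, hU, W, hW, rfl⟩
  set π := σ.permMatrix ℂ
  have hU' := inv_mem_upperBorel hU.1
  have hW' := inv_mem_upperBorel hW.1
  have hππ' : π⁻¹ * π = 1 := Matrix.nonsing_inv_mul π (isUnit_det_permMatrix σ)
  have hUU : ((U⁻¹ : GL (Fin n) ℂ) : Matrix (Fin n) (Fin n) ℂ) * U = 1 := U.inv_mul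
  refine ⟨⟨?_, ?_⟩, ?_⟩
  · rw [actPair_torusPoint_X_mul_Y]
    exact (Matrix.BlockTriangular.mul hU.1 (blockTriangular_diagonal _)).mul hU'
  · have : (actPair U W (torusPoint π s t)).Y * (actPair U W (torusPoint π s t)).X =
        W * Matrix.diagonal (fun i => s i * t i) *
          ((W⁻¹ : GL (Fin n) ℂ) : Matrix (Fin n) (Fin n) ℂ) := by
      simp only [actPair, actMat, torusPoint]
      calc _ = W * diagonal s * (π⁻¹ * (((U⁻¹ : GL (Fin n) ℂ) : Matrix (Fin n) (Fin n) ℂ) * U) * π)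
            * diagonal t * ((W⁻¹ : GL (Fin n) ℂ) : Matrix (Fin n) (Fin n) ℂ) := by
              simp only [Matrix.mul_assoc]
        _ = _ := by
          rw [hUU, Matrix.mul_one, hππ', Matrix.mul_one, Matrix.mul_assoc _ (diagonal s),
            Matrix.diagonal_mul_diagonal]
    rw [this]
    exact (Matrix.BlockTriangular.mul hW.1 (blockTriangular_diagonal _)).mul hW'
  · obtain ⟨D, hD, hDt⟩ := exists_mem_upperBorel (blockTriangular_diagonal t)
      (Matrix.BlockTriangular.det_ne_zero (blockTriangular_diagonal t) (by simpa using ht))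
    refine ⟨U, hU.1, W * D⁻¹, mul_mem_upperBorel hW.1 (inv_mem_upperBorel hD), ?_⟩
    have hWD : (((W * D⁻¹)⁻¹ : GL (Fin n) ℂ) : Matrix (Fin n) (Fin n) ℂ) =
        diagonal t * ((W⁻¹ : GL (Fin n) ℂ) : Matrix (Fin n) (Fin n) ℂ) := by
      rw [_root_.mul_inv_rev, inv_inv, Units.val_mul, hDt]
    simp only [actPair, actMat, torusPoint, hWD, Matrix.mul_assoc]

/-- The pairs `(X, Y)` such that the diagonal entries of `X Y` are nonzero and pairwise distinct. -/
def genericPairs (n : ℕ) : Set (MatPair n) :=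
  {P | (∀ i, (P.X * P.Y) i i ≠ 0) ∧ ∀ i j, i ≠ j → (P.X * P.Y) i i - (P.X * P.Y) j j ≠ 0}

theorem isOpen_genericPairs (n : ℕ) : IsOpen (genericPairs n) := by
  let d (i : Fin n) : MvPolynomial (MatPair.Coord n) ℂ :=
    ∑ k, MvPolynomial.X (.inl (i, k)) * MvPolynomial.X (.inr (k, i))
  have hd : ∀ (P : MatPair n) i, (P.X * P.Y) i i = MvPolynomial.eval P.coords (d i) :=
    fun P i => by simp [d, Matrix.mul_apply, MatPair.coords]
  have : genericPairs n = (⋂ i, {P | MvPolynomial.eval P.coords (d i) ≠ 0}) ∩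
      ⋂ i, ⋂ j, ⋂ _ : i ≠ j, {P | MvPolynomial.eval P.coords (d i - d j) ≠ 0} := by
    ext P
    simp [genericPairs, hd]
  rw [this]
  exact (isOpen_iInter_of_finite fun i => MatPair.isOpen_eval_ne_zero _).inter
    (isOpen_iInter_of_finite fun i => isOpen_iInter_of_finite fun j =>
      isOpen_iInter_of_finite fun _ => MatPair.isOpen_eval_ne_zero _)

theorem genericTorusOrbits_subset_torusOrbits (π : Matrix (Fin n) (Fin n) ℂ) :
    genericTorusOrbits π ⊆ torusOrbits π := by
  rintro _ ⟨s, t, hs, ht, -, U, hU, W, hW, rfl⟩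
  exact ⟨s, t, hs, ht, U, hU, W, hW, rfl⟩

theorem genericTorusOrbits_subset_genericPairs :
    genericTorusOrbits (σ.permMatrix ℂ) ⊆ genericPairs n := by
  rintro _ ⟨s, t, hs, ht, hst, U, hU, W, hW, rfl⟩
  have hd : ∀ i, ((actPair U W (torusPoint (σ.permMatrix ℂ) s t)).X *
      (actPair U W (torusPoint (σ.permMatrix ℂ) s t)).Y) i i = s (σ i) * t (σ i) := fun i => by
    have h := Matrix.BlockTriangular.inv_mul_mul_apply_self (inv_mem_upperBorel hU.1)
      (isUnit_det_coe U⁻¹)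
      (blockTriangular_diagonal fun i => t (σ i) * s (σ i)) i
    rw [← Matrix.coe_units_inv, inv_inv, Matrix.diagonal_apply_eq] at h
    rw [actPair_torusPoint_X_mul_Y, h, mul_comm]
  simp only [genericPairs, Set.mem_ofPred_eq, hd]
  refine ⟨fun i => mul_ne_zero (hs _) (ht _), fun i j hij => sub_ne_zero.2 fun h => hij ?_⟩
  exact σ.injective (hst h)

/-- A pair in the stratum with generic diagonal of `X Y` is brought to the form `(π t, s π⁻¹)` by
diagonalizing `X Y` and `Y X` simultaneously: after a translation to `X = π`, the matrix `M = X Y`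
is triangular both for the usual order and for its image under the permutation, and so is
the matrix that diagonalizes it. -/
theorem stratum_inter_genericPairs_subset :
    stratum (σ.permMatrix ℂ) ∩ genericPairs n ⊆ genericTorusOrbits (σ.permMatrix ℂ) := by
  rintro P ⟨⟨⟨hXY, hYX⟩, U, hU, W, hW, hX⟩, hne, hdist⟩
  set π := σ.permMatrix ℂ
  have hππ : π * π⁻¹ = 1 := Matrix.mul_nonsing_inv π (isUnit_det_permMatrix σ)
  have hUU : ((U⁻¹ : GL (Fin n) ℂ) : Matrix (Fin n) (Fin n) ℂ) * U = 1 := U.inv_mul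
  have hWW : ((W⁻¹ : GL (Fin n) ℂ) : Matrix (Fin n) (Fin n) ℂ) * W = 1 := W.inv_mul
  have hWW' : (W : Matrix (Fin n) (Fin n) ℂ) * ((W⁻¹ : GL (Fin n) ℂ) : Matrix _ _ ℂ) = 1 :=
    W.mul_inv
  have hXW : P.X * W = U * π := by
    rw [hX, actMat, Matrix.mul_assoc, hWW, Matrix.mul_one]
  let Z : Matrix (Fin n) (Fin n) ℂ := ((W⁻¹ : GL (Fin n) ℂ) : Matrix (Fin n) (Fin n) ℂ) * P.Y * U
  have hM : π * Z = (U : Matrix (Fin n) (Fin n) ℂ)⁻¹ * (P.X * P.Y) * U := by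
    have : π = ((U⁻¹ : GL (Fin n) ℂ) : Matrix (Fin n) (Fin n) ℂ) * (P.X * W) := by
      rw [hXW, ← Matrix.mul_assoc, hUU, Matrix.one_mul]
    rw [this, ← Matrix.coe_units_inv]
    calc _ = ((U⁻¹ : GL (Fin n) ℂ) : Matrix (Fin n) (Fin n) ℂ) * (P.X *
          ((W : Matrix (Fin n) (Fin n) ℂ) * ((W⁻¹ : GL (Fin n) ℂ) : Matrix _ _ ℂ)) * P.Y) *
          (U : Matrix (Fin n) (Fin n) ℂ) := by
            simp only [Z, Matrix.mul_assoc]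
      _ = _ := by rw [hWW', Matrix.mul_one]
  have hN : Z * π = ((W⁻¹ : GL (Fin n) ℂ) : Matrix (Fin n) (Fin n) ℂ) * (P.Y * P.X) * W := by
    simp only [Z, Matrix.mul_assoc, hXW]
  have hMt : (π * Z).BlockTriangular id := by
    rw [hM, ← Matrix.coe_units_inv]
    exact (Matrix.BlockTriangular.mul (inv_mem_upperBorel hU) hXY).mul hU
  have hNt : (Z * π).BlockTriangular id := by
    rw [hN]
    exact (Matrix.BlockTriangular.mul (inv_mem_upperBorel hW) hYX).mul hW
  have hMN : Z * π = (π * Z).submatrix σ.symm σ.symm := by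
    ext i j
    rw [Matrix.submatrix_apply, permMatrix_mul_apply, mul_permMatrix_apply, Equiv.apply_symm_apply]
  have hMσ : (π * Z).BlockTriangular σ := fun i j hij => by
    have := hNt hij
    rwa [hMN, Matrix.submatrix_apply, Equiv.symm_apply_apply, Equiv.symm_apply_apply] at this
  have hMd : ∀ i, (π * Z) i i = (P.X * P.Y) i i := fun i => by
    rw [hM]
    exact Matrix.BlockTriangular.inv_mul_mul_apply_self hU (isUnit_det_coe U) hXY i
  obtain ⟨T, hTt, hTd, hMT⟩ := exists_diagonalization hMt fun i j hij => by
    by_contra h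
    refine hdist i j h (sub_eq_zero.2 ?_)
    simpa only [hMd] using hij
  let d : Fin n → ℂ := fun i => (π * Z) i i
  have hd : ∀ i, d i ≠ 0 := fun i => by
    simp only [d, hMd]
    exact hne i
  have hd' : Function.Injective d := fun i j hij => by
    by_contra h
    refine hdist i j h (sub_eq_zero.2 ?_)
    simpa only [d, hMd] using hij
  let T' : Matrix (Fin n) (Fin n) ℂ := T.submatrix σ.symm σ.symm
  have hTπ : π * T' = T * π := by
    ext i j
    rw [permMatrix_mul_apply, mul_permMatrix_apply]
    simp only [T', Matrix.submatrix_apply, Equiv.symm_apply_apply]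
  have hT't : T'.BlockTriangular id := fun i j hij => hTt σ hMσ (by simpa using hij)
  have hNT : Z * π * T' = T' * diagonal fun i => d (σ.symm i) := by
    have := congrArg (fun A : Matrix (Fin n) (Fin n) ℂ => A.submatrix σ.symm σ.symm) hMT
    rw [← Matrix.submatrix_mul_equiv (π * Z) T _ σ.symm, ← Matrix.submatrix_mul_equiv T _ _ σ.symm,
      Matrix.submatrix_diagonal_equiv] at this
    rw [hMN]
    exact this
  -- Absorb `T` and `T'` into the translations and split off the diagonal parts.
  obtain ⟨V, hV, hVT⟩ := exists_mem_upperBorel (hTt id hMt)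
    (Matrix.BlockTriangular.det_ne_zero (hTt id hMt) hTd)
  obtain ⟨V', hV', hVT'⟩ := exists_mem_upperBorel hT't
    (Matrix.BlockTriangular.det_ne_zero hT't fun i => hTd _)
  obtain ⟨N, hNu, a, ha, hNa⟩ := exists_unipotent_mul_diagonal (mul_mem_upperBorel hU hV)
  obtain ⟨N', hNu', b, hb, hNb⟩ := exists_unipotent_mul_diagonal (mul_mem_upperBorel hW hV')
  rw [Units.val_mul, hVT] at hNa
  rw [Units.val_mul, hVT'] at hNb
  have hbb : diagonal b * diagonal (fun i => (b i)⁻¹) = 1 := by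
    rw [Matrix.diagonal_mul_diagonal]
    simp [hb]
  have haa : diagonal (fun i => a (σ.symm i)) * diagonal (fun i => (a (σ.symm i))⁻¹) = 1 := by
    rw [Matrix.diagonal_mul_diagonal]
    simp [ha]
  have hXN : P.X * N' = N * (π * diagonal fun i => a (σ.symm i) * (b i)⁻¹) := by
    calc P.X * N' = P.X * (N' * diagonal b) * diagonal (fun i => (b i)⁻¹) := by
          rw [← Matrix.mul_assoc, Matrix.mul_assoc _ (diagonal b), hbb, Matrix.mul_one]
      _ = U * T * π * diagonal (fun i => (b i)⁻¹) := by
          rw [← hNb, ← Matrix.mul_assoc, hXW, Matrix.mul_assoc _ π, hTπ, ← Matrix.mul_assoc]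
      _ = _ := by
          rw [hNa, Matrix.mul_assoc _ _ π, diagonal_mul_permMatrix, Matrix.mul_assoc,
            Matrix.mul_assoc, Matrix.diagonal_mul_diagonal]
  have hYN : P.Y * N = N' * (diagonal (fun i => b i * d (σ.symm i) * (a (σ.symm i))⁻¹) * π⁻¹) := by
    have hWZ : P.Y * U = W * Z := by
      simp only [Z, ← Matrix.mul_assoc, hWW', Matrix.one_mul]
    calc P.Y * N = P.Y * (N * diagonal a * π) * diagonal (fun i => (a (σ.symm i))⁻¹) * π⁻¹ := by
          rw [Matrix.mul_assoc _ (diagonal a), diagonal_mul_permMatrix]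
          simp only [Matrix.mul_assoc]
          rw [← Matrix.mul_assoc (diagonal fun i => a (σ.symm i)), haa, Matrix.one_mul, hππ,
            Matrix.mul_one]
      _ = W * (Z * π * T') * diagonal (fun i => (a (σ.symm i))⁻¹) * π⁻¹ := by
          rw [← hNa, Matrix.mul_assoc _ T, ← hTπ, ← Matrix.mul_assoc P.Y, hWZ]
          simp only [Matrix.mul_assoc]
      _ = _ := by
          rw [hNT, ← Matrix.mul_assoc (W : Matrix (Fin n) (Fin n) ℂ), hNb,
            Matrix.mul_assoc _ (diagonal b), Matrix.diagonal_mul_diagonal,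
            Matrix.mul_assoc _ _ (diagonal _), Matrix.diagonal_mul_diagonal, Matrix.mul_assoc]
  refine ⟨fun i => b i * d (σ.symm i) * (a (σ.symm i))⁻¹, fun i => a (σ.symm i) * (b i)⁻¹,
    fun i => mul_ne_zero (mul_ne_zero (hb i) (hd _)) (inv_ne_zero (ha _)),
    fun i => mul_ne_zero (ha (σ.symm i)) (inv_ne_zero (hb i)), fun i j hij => ?_,
    N, hNu, N', hNu', MatPair.ext ?_ ?_⟩
  · have hcancel : ∀ i, b i * d (σ.symm i) * (a (σ.symm i))⁻¹ * (a (σ.symm i) * (b i)⁻¹) =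
        d (σ.symm i) := fun i => by
      have := ha (σ.symm i)
      have := hb i
      field_simp
    simp only [hcancel] at hij
    exact σ.symm.injective (hd' hij)
  · simp only [actPair, actMat, torusPoint]
    rw [← hXN, Matrix.mul_assoc, ← Units.val_mul, mul_inv_cancel, Units.val_one, Matrix.mul_one]
  · simp only [actPair, actMat, torusPoint]
    rw [← hYN, Matrix.mul_assoc, ← Units.val_mul, mul_inv_cancel, Units.val_one, Matrix.mul_one]

theorem genericTorusOrbits_eq :
    genericTorusOrbits (σ.permMatrix ℂ) = stratum (σ.permMatrix ℂ) ∩ genericPairs n :=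
  Set.Subset.antisymm (fun _ hP => ⟨torusOrbits_subset_stratum σ
    (genericTorusOrbits_subset_torusOrbits _ hP), genericTorusOrbits_subset_genericPairs σ hP⟩)
    (stratum_inter_genericPairs_subset σ)

theorem genericTorusOrbits_nonempty (π : Matrix (Fin n) (Fin n) ℂ) :
    (genericTorusOrbits π).Nonempty := by
  have h1 : (1 : GL (Fin n) ℂ) ∈ upperUnipotent n := by
    refine ⟨?_, fun i => ?_⟩
    · rw [Units.val_one]
      exact blockTriangular_one
    · simp
  refine ⟨_, fun _ => 1, fun i => (i : ℕ) + 1, fun _ => one_ne_zero,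
    fun i => Nat.cast_add_one_ne_zero _, fun i j hij => Fin.ext ?_, 1, h1, 1, h1, rfl⟩
  simpa using hij

end Generic

theorem mainTheorem7 (n : ℕ) (π : Matrix (Fin n) (Fin n) ℂ) (hπ : IsPartialPermMatrix π) :
    (MatPair.IsSmoothLocallyClosed (stratum π) ∧
      IsIrreducible (stratum π) ∧
      topologicalKrullDim (stratum π) = ((n ^ 2 + π.rank : ℕ) : WithBot ℕ∞)) ∧
    (IsPermMatrix π →
      IsOpenDenseIn (genericTorusOrbits π) (stratum π) ∧
      torusOrbits π ⊆ stratum π ∧ stratum π ⊆ closure (torusOrbits π)) := by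
  obtain ⟨f, hf, hπf⟩ := PivotWord.exists_isPivotWord hπ
  obtain ⟨c⟩ := PivotWord.exists_rationalChart hf
  rw [← hπf] at c
  have hirr : IsIrreducible (stratum π) := c.isIrreducible
  refine ⟨⟨⟨c.isLocallyClosed, c.mem_smoothLocus⟩, hirr, ?_⟩, ?_⟩
  · rw [c.topologicalKrullDim_eq, PivotWord.card_paramIdx hf, hπf]
  · rintro ⟨σ, rfl⟩
    have heq := genericTorusOrbits_eq σ
    have hdense : stratum (σ.permMatrix ℂ) ⊆ closure (genericTorusOrbits (σ.permMatrix ℂ)) := by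
      have hne := genericTorusOrbits_nonempty (σ.permMatrix ℂ)
      rw [heq] at hne ⊢
      exact subset_closure_inter_of_isPreirreducible_of_isOpen hirr.isPreirreducible
        (isOpen_genericPairs n) hne
    exact ⟨⟨⟨_, isOpen_genericPairs n, heq⟩, hdense⟩, torusOrbits_subset_stratum σ,
      hdense.trans (closure_mono (genericTorusOrbits_subset_torusOrbits _))⟩
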